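/- Let $\tau,\nu\ge 0$ be real numbers with $\nu^2\ge(\tau-1)^2$, and let $\mathcal P$ be the one-mode phase-insensitive Gaussian channel with parameters $\tau,\nu$, i.e. the completely positive trace-preserving linear map on the trace-class operators of one bosonic mode that transforms the characteristic function $\chi_\rho(\mu)=\operatorname{Tr}[\rho D(\mu)]$, $D(\mu)=\exp(\mu\hat a^\dagger-\mu^*\hat a)$, of every density operator $\rho$ as $$\chi_{\mathcal P(\rho)}(\mu)=\chi_\rho(\sqrt\tau\,\mu)\,e^{-\nu|\mu|^2/2}\qquad(\mu\in\mathbb C).$$ For $L\in\mathbb N$ let $\Pi_L=\sum_{a_1+\dots+a_n\le L}|a_1\rangle\langle a_1|\otimes\cdots\otimes|a_n\rangle\langle a_n|$ be the projector onto the states of $n$ modes with total photon number at most $L$ (with $|a\rangle$ the number states). Let $N_S\ge 0$ and put $N_S'=\tau N_S+(\tau+\nu-1)/2$. Then for every $\delta_2>0$ there is a non-increasing function $\delta_3:\mathbb N\to\mathbb R$ with $\delta_3(n)\to 0$ as $n\to\infty$ (depending only on $\mathcal P$, $N_S$ and $\delta_2$) such that, for every function $\delta_1:\mathbb N\to[0,\infty)$,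 every $n$ and every density operator $\rho^{(n)}$ on $n$ modes, $$\operatorname{Tr}\{\Pi_{\lceil nN_S\rceil}\,\rho^{(n)}\}\ge 1-\delta_1(n)$$ implies $$\operatorname{Tr}\{\Pi_{\lceil n(N_S'+\delta_2)\rceil}\,\mathcal P^{\otimes n}(\rho^{(n)})\}\ge 1-\delta_1(n)-2\sqrt{\delta_1(n)}-\delta_3(n).$$ -/

import Mathlib

/-! ### Fock space, number states and trace -/

/-- The Hilbert space `ℓ²(ι)` whose canonical orthonormal basis is labelled by `ι`.
`Fock ℕ` is the Hilbert space of one bosonic mode (label: photon number), and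
`Fock (Fin n → ℕ)` is the Hilbert space of `n` modes (label: the string `a₁, …, aₙ`). -/
abbrev Fock (ι : Type) : Type := lp (fun _ : ι => ℂ) 2

/-- The number state `|a⟩`. -/
noncomputable def ket {ι : Type} [DecidableEq ι] (a : ι) : Fock ι := lp.single 2 a (1 : ℂ)

/-- The trace `∑ₐ ⟨a|A|a⟩`. -/
noncomputable def fockTrace {ι : Type} [DecidableEq ι] (A : Fock ι →L[ℂ] Fock ι) : ℂ :=
  ∑' a : ι, inner ℂ (ket a) (A (ket a))

/-- The space of trace-class operators: the linear span of the positive operators of finite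
trace. -/
noncomputable def TraceClass (ι : Type) [DecidableEq ι] : Submodule ℂ (Fock ι →L[ℂ] Fock ι) :=
  Submodule.span ℂ
    {A | A.IsPositive ∧ Summable fun a : ι => inner ℂ (ket a) (A (ket a))}

/-- Density operators: positive trace-class operators of trace one. -/
def IsDensity {ι : Type} [DecidableEq ι] (A : TraceClass ι) : Prop :=
  (A : Fock ι →L[ℂ] Fock ι).IsPositive ∧
    HasSum (fun a : ι => inner ℂ (ket a) ((A : Fock ι →L[ℂ] Fock ι) (ket a))) 1

/-! ### Quantum channels and their tensor powers -/

/-- A `k × k` block of operators is positive as an operator on the `k`-fold direct sum. -/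
def BlockPositive {ι : Type} [DecidableEq ι] {k : ℕ} (A : Fin k → Fin k → TraceClass ι) : Prop :=
  ∀ v : Fin k → Fock ι,
    0 ≤ (∑ i, ∑ j, inner ℂ (v i) ((A i j : Fock ι →L[ℂ] Fock ι) (v j))).re ∧
      (∑ i, ∑ j, inner ℂ (v i) ((A i j : Fock ι →L[ℂ] Fock ι) (v j))).im = 0

/-- Quantum channels: completely positive trace-preserving linear maps of trace-class
operators. -/
structure IsChannel {ι κ : Type} [DecidableEq ι] [DecidableEq κ]
    (Φ : TraceClass ι →ₗ[ℂ] TraceClass κ) : Prop where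
  completelyPositive : ∀ (k : ℕ) (A : Fin k → Fin k → TraceClass ι),
    BlockPositive A → BlockPositive (fun i j => Φ (A i j))
  tracePreserving : ∀ A : TraceClass ι,
    fockTrace (Φ A : Fock κ →L[ℂ] Fock κ) = fockTrace (A : Fock ι →L[ℂ] Fock ι)

/-- `B = A₁ ⊗ ⋯ ⊗ Aₙ`, where `|a₁, …, aₙ⟩ = |a₁⟩ ⊗ ⋯ ⊗ |aₙ⟩`. -/
def IsProductOperator {n : ℕ} (A : Fin n → TraceClass ℕ) (B : TraceClass (Fin n → ℕ)) : Prop :=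
  ∀ l m : Fin n → ℕ,
    inner ℂ (ket l) ((B : Fock (Fin n → ℕ) →L[ℂ] Fock (Fin n → ℕ)) (ket m)) =
      ∏ i, inner ℂ (ket (l i)) ((A i : Fock ℕ →L[ℂ] Fock ℕ) (ket (m i)))

/-- `Q = P^{⊗n}`: the channel on `n` modes with
`Q (A₁ ⊗ ⋯ ⊗ Aₙ) = P A₁ ⊗ ⋯ ⊗ P Aₙ`. -/
structure IsTensorPower {n : ℕ} (P : TraceClass ℕ →ₗ[ℂ] TraceClass ℕ)
    (Q : TraceClass (Fin n → ℕ) →ₗ[ℂ] TraceClass (Fin n → ℕ)) : Prop where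
  channel : IsChannel Q
  map_tensor : ∀ (A : Fin n → TraceClass ℕ) (B : TraceClass (Fin n → ℕ)),
    IsProductOperator A B → IsProductOperator (fun i => P (A i)) (Q B)

/-! ### Displacement operators -/

/-- The creation operator `a†` on finite superpositions of number states. -/
noncomputable def creation : (ℕ →₀ ℂ) →ₗ[ℂ] (ℕ →₀ ℂ) :=
  Finsupp.linearCombination ℂ fun k : ℕ => Finsupp.single (k + 1) ((Real.sqrt (k + 1) : ℝ) : ℂ)

/-- The annihilation operator `a` on finite superpositions of number states
(the coefficient vanishes for `k = 0`, so `a|0⟩ = 0`). -/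
noncomputable def annihilation : (ℕ →₀ ℂ) →ₗ[ℂ] (ℕ →₀ ℂ) :=
  Finsupp.linearCombination ℂ fun k : ℕ => Finsupp.single (k - 1) ((Real.sqrt k : ℝ) : ℂ)

/-- `μ a† - μ* a`. -/
noncomputable def displacementGenerator (μ : ℂ) : (ℕ →₀ ℂ) →ₗ[ℂ] (ℕ →₀ ℂ) :=
  μ • creation - (starRingEnd ℂ μ) • annihilation

/-- A finite superposition of number states as a vector of the one-mode Hilbert space. -/
noncomputable def toFock : (ℕ →₀ ℂ) →ₗ[ℂ] Fock ℕ :=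
  Finsupp.linearCombination ℂ fun k : ℕ => ket k

/-- `∑ⱼ (μ a† - μ* a)ʲ |k⟩ / j!`, a norm-convergent series. -/
noncomputable def displacedKet (μ : ℂ) (k : ℕ) : Fock ℕ :=
  ∑' j : ℕ, ((j.factorial : ℂ)⁻¹) •
    toFock ((displacementGenerator μ ^ j) (Finsupp.single k 1))

theorem ket_inner (i j : ℕ) : inner ℂ (ket i) (ket j) = if i = j then (1 : ℂ) else 0 := by
  unfold ket
  rw [lp.inner_single_left, lp.single_apply]
  by_cases h : i = j
  · subst h; simp
  · simp [h]

theorem ket_norm (i : ℕ) : ‖(ket i : Fock ℕ)‖ = 1 := by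
  unfold ket
  rw [lp.norm_single (by norm_num)]
  simp

theorem toFock_single (k : ℕ) (c : ℂ) : toFock (Finsupp.single k c) = c • ket k := by
  simp [toFock]

theorem generator_single (μ : ℂ) (k : ℕ) :
    displacementGenerator μ (Finsupp.single k 1) =
      (μ * (Real.sqrt (k + 1) : ℝ)) • Finsupp.single (k + 1) 1 -
        (starRingEnd ℂ μ * (Real.sqrt k : ℝ)) • Finsupp.single (k - 1) 1 := by
  simp [displacementGenerator, creation, annihilation, Finsupp.smul_single]

theorem generator_skew_single (μ : ℂ) (k l : ℕ) :
    inner ℂ (toFock (displacementGenerator μ (Finsupp.single k 1))) (toFock (Finsupp.single l 1)) =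
      - inner ℂ (toFock (Finsupp.single k 1))
          (toFock (displacementGenerator μ (Finsupp.single l 1))) := by
  rw [generator_single, generator_single]
  simp only [map_sub, map_smul, toFock_single, inner_sub_left, inner_sub_right, inner_smul_left,
    inner_smul_right, ket_inner, one_smul, map_mul, Complex.conj_ofReal, Complex.conj_conj]
  rcases k with _ | k <;> rcases l with _ | l
  · simp
  · simp only [Nat.cast_zero, Real.sqrt_zero, Nat.add_sub_cancel]
    by_cases h : l = 0
    · subst h; simp
    · have h2 : ¬ (0 = l) := by omega
      simp [h, h2]
  · simp only [Nat.cast_zero, Real.sqrt_zero, Nat.add_sub_cancel]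
    by_cases h : k = 0
    · subst h; simp
    · simp [h]
  · simp only [Nat.add_sub_cancel]
    by_cases h : k + 1 = l
    · subst h
      have h1 : ¬ (k = k + 1 + 1) := by omega
      simp [h1]
    · by_cases h' : k = l + 1
      · subst h'
        simp [h]
      · simp [h, h']

theorem generator_skew (μ : ℂ) (u v : ℕ →₀ ℂ) :
    inner ℂ (toFock (displacementGenerator μ u)) (toFock v) =
      - inner ℂ (toFock u) (toFock (displacementGenerator μ v)) := by
  induction u using Finsupp.induction_linear with
  | zero => simp
  | add f g hf hg => simp only [map_add, inner_add_left, hf, hg]; ring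
  | single k c =>
    induction v using Finsupp.induction_linear with
    | zero => simp
    | add f g hf hg => simp only [map_add, inner_add_right, hf, hg]; ring
    | single l d =>
      have hk : (Finsupp.single k c : ℕ →₀ ℂ) = c • Finsupp.single k 1 := by simp
      have hl : (Finsupp.single l d : ℕ →₀ ℂ) = d • Finsupp.single l 1 := by simp
      rw [hk, hl]
      simp only [map_smul, inner_smul_left, inner_smul_right, generator_skew_single]
      ring

theorem generator_skew_pow (μ : ℂ) (i j : ℕ) (u v : ℕ →₀ ℂ) :
    inner ℂ (toFock ((displacementGenerator μ ^ i) u)) (toFock ((displacementGenerator μ ^ j) v)) =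
      (-1) ^ i * inner ℂ (toFock u) (toFock ((displacementGenerator μ ^ (i + j)) v)) := by
  induction i generalizing j with
  | zero => simp
  | succ i ih =>
    rw [pow_succ', Module.End.mul_apply, generator_skew, ← Module.End.mul_apply, ← pow_succ', ih]
    rw [show i + (j + 1) = i + 1 + j by ring]
    ring

theorem generator_pow_bound (μ : ℂ) (j k : ℕ) :
    ‖toFock ((displacementGenerator μ ^ j) (Finsupp.single k 1))‖ ≤
      (2 * ‖μ‖) ^ j * Real.sqrt ((k + 1).ascFactorial j) := by
  induction j generalizing k with
  | zero => simp [toFock_single, ket_norm]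
  | succ j ih =>
    have e1 : Real.sqrt (k + 1) * Real.sqrt ((k + 1 + 1).ascFactorial j) =
        Real.sqrt ((k + 1).ascFactorial (j + 1)) := by
      rw [← Real.sqrt_mul (by positivity), Nat.ascFactorial_succ, ← Nat.succ_ascFactorial]
      push_cast; rfl
    have e2 : Real.sqrt k * Real.sqrt ((k - 1 + 1).ascFactorial j) ≤
        Real.sqrt ((k + 1).ascFactorial (j + 1)) := by
      rcases k with _ | k
      · simp
      · rw [← Real.sqrt_mul (by positivity)]
        apply Real.sqrt_le_sqrt
        rw [Nat.ascFactorial_succ, Nat.add_sub_cancel]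
        have h : (k + 1) * (k + 1).ascFactorial j ≤
            (k + 1 + 1 + j) * (k + 1 + 1).ascFactorial j :=
          Nat.mul_le_mul (by omega) (Nat.ascFactorial_le j (by omega))
        exact_mod_cast h
    rw [pow_succ, Module.End.mul_apply, generator_single, map_sub, map_sub, map_smul, map_smul,
      map_smul, map_smul]
    refine (norm_sub_le _ _).trans ?_
    rw [norm_smul, norm_smul, norm_mul, norm_mul, RCLike.norm_conj, Complex.norm_real,
      Complex.norm_real, Real.norm_of_nonneg (Real.sqrt_nonneg _),
      Real.norm_of_nonneg (Real.sqrt_nonneg _)]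
    have i1 := ih (k + 1)
    have i2 := ih (k - 1)
    calc _ ≤ ‖μ‖ * Real.sqrt (k + 1) *
            ((2 * ‖μ‖) ^ j * Real.sqrt ((k + 1 + 1).ascFactorial j)) +
          ‖μ‖ * Real.sqrt k * ((2 * ‖μ‖) ^ j * Real.sqrt ((k - 1 + 1).ascFactorial j)) := by
          gcongr
      _ = ‖μ‖ * (2 * ‖μ‖) ^ j * (Real.sqrt (k + 1) * Real.sqrt ((k + 1 + 1).ascFactorial j) +
            Real.sqrt k * Real.sqrt ((k - 1 + 1).ascFactorial j)) := by ring
      _ ≤ ‖μ‖ * (2 * ‖μ‖) ^ j * (Real.sqrt ((k + 1).ascFactorial (j + 1)) +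
            Real.sqrt ((k + 1).ascFactorial (j + 1))) := by
          rw [e1]; gcongr
      _ = _ := by ring

theorem displacedKet_summable_norm (μ : ℂ) (k : ℕ) :
    Summable fun j : ℕ => ‖((j.factorial : ℂ)⁻¹) •
      toFock ((displacementGenerator μ ^ j) (Finsupp.single k 1))‖ := by
  set c : ℝ := 2 * ‖μ‖ with hc
  have hc0 : 0 ≤ c := by positivity
  have key : Summable fun j : ℕ =>
      ((j.factorial : ℝ)⁻¹) * (c ^ j * Real.sqrt ((k + 1).ascFactorial j)) := by
    refine summable_of_ratio_norm_eventually_le (r := 1 / 2) (by norm_num) ?_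
    obtain ⟨N, hN⟩ := exists_nat_ge ((2 * c) ^ 2 * (k + 1))
    filter_upwards [Filter.eventually_ge_atTop N] with j hj
    rw [Real.norm_of_nonneg (by positivity), Real.norm_of_nonneg (by positivity)]
    have hjN : (N : ℝ) ≤ j := by exact_mod_cast hj
    have h1 : 2 * c * Real.sqrt (k + 1 + j) ≤ j + 1 := by
      have : Real.sqrt ((2 * c) ^ 2 * (k + 1 + j)) ≤ j + 1 := by
        rw [Real.sqrt_le_left (by positivity)]
        have hk : (0 : ℝ) ≤ k := by positivity
        have hj0 : (0 : ℝ) ≤ j := by positivity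
        have : (k + 1 + j : ℝ) ≤ (k + 1) * (j + 1) := by nlinarith
        calc (2 * c) ^ 2 * (k + 1 + j) ≤ (2 * c) ^ 2 * ((k + 1) * (j + 1)) := by gcongr
          _ = ((2 * c) ^ 2 * (k + 1)) * (j + 1) := by ring
          _ ≤ (j + 1) * (j + 1) := by gcongr; linarith
          _ = (j + 1 : ℝ) ^ 2 := by ring
      rwa [Real.sqrt_mul (by positivity), Real.sqrt_sq (by positivity)] at this
    have h2 : Real.sqrt ((k + 1).ascFactorial (j + 1)) =
        Real.sqrt (k + 1 + j) * Real.sqrt ((k + 1).ascFactorial j) := by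
      rw [← Real.sqrt_mul (by positivity), Nat.ascFactorial_succ]
      push_cast; rfl
    rw [h2, Nat.factorial_succ]
    push_cast
    have hf : (0 : ℝ) < j.factorial := by positivity
    rw [mul_inv]
    have : ((j : ℝ) + 1)⁻¹ * (c * Real.sqrt (k + 1 + j)) ≤ 1 / 2 := by
      rw [inv_mul_le_iff₀ (by positivity)]; linarith
    calc _ = (((j : ℝ) + 1)⁻¹ * (c * Real.sqrt (k + 1 + j))) *
          ((j.factorial : ℝ)⁻¹ * (c ^ j * Real.sqrt ((k + 1).ascFactorial j))) := by ring
      _ ≤ _ := by gcongr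
  refine Summable.of_nonneg_of_le (fun _ => norm_nonneg _) (fun j => ?_) key
  rw [norm_smul, norm_inv, Complex.norm_natCast]
  gcongr
  exact generator_pow_bound μ j k

theorem displacedKet_orthonormal (μ : ℂ) : Orthonormal ℂ (displacedKet μ) := by
  rw [orthonormal_iff_ite]
  intro k l
  set f : ℕ → Fock ℕ := fun j => ((j.factorial : ℂ)⁻¹) •
    toFock ((displacementGenerator μ ^ j) (Finsupp.single k 1)) with hf
  set g : ℕ → Fock ℕ := fun j => ((j.factorial : ℂ)⁻¹) •
    toFock ((displacementGenerator μ ^ j) (Finsupp.single l 1)) with hg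
  have sf : Summable fun j => ‖f j‖ := displacedKet_summable_norm μ k
  have sg : Summable fun j => ‖g j‖ := displacedKet_summable_norm μ l
  have hprod : Summable fun p : ℕ × ℕ => inner ℂ (f p.1) (g p.2) := by
    refine Summable.of_norm_bounded
      (sf.mul_of_nonneg sg (fun _ => norm_nonneg _) (fun _ => norm_nonneg _)) ?_
    intro p
    exact norm_inner_le_norm _ _
  have h1 : inner ℂ (displacedKet μ k) (displacedKet μ l) =
      ∑' p : ℕ × ℕ, inner ℂ (f p.1) (g p.2) := by
    rw [hprod.tsum_prod]
    have e1 : ∀ i, ∑' j, inner ℂ (f i) (g j) = inner ℂ (f i) (∑' j, g j) := fun i =>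
      ((innerSL ℂ (f i)).map_tsum sg.of_norm).symm
    simp_rw [e1]
    have e2 := (innerSL ℂ (∑' j, g j)).map_tsum sf.of_norm
    have e3 : ∑' i, inner ℂ (f i) (∑' j, g j) =
        starRingEnd ℂ (∑' i, inner ℂ (∑' j, g j) (f i)) := by
      rw [Complex.conj_tsum]
      simp
    rw [e3]
    simp only [innerSL_apply_apply] at e2
    rw [← e2, inner_conj_symm]
    rfl
  rw [h1, ← Finset.HasAntidiagonal.sigmaAntidiagonalEquivProd.tsum_eq]
  have hsig := (Finset.HasAntidiagonal.sigmaAntidiagonalEquivProd (A := ℕ)).summable_iff.mpr hprod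
  refine (Summable.tsum_sigma' (fun n => (hasSum_fintype _).summable) hsig).trans ?_
  have h2 : ∀ n : ℕ, (∑' c : Finset.HasAntidiagonal.antidiagonal n,
      inner ℂ (f (Finset.HasAntidiagonal.sigmaAntidiagonalEquivProd ⟨n, c⟩).1)
        (g (Finset.HasAntidiagonal.sigmaAntidiagonalEquivProd ⟨n, c⟩).2)) =
      if n = 0 then inner ℂ (ket k) (ket l) else 0 := by
    intro n
    rw [tsum_fintype]
    simp only [Finset.HasAntidiagonal.sigmaAntidiagonalEquivProd_apply]
    rw [Finset.univ_eq_attach,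
      Finset.sum_attach (Finset.HasAntidiagonal.antidiagonal n) (fun p => inner ℂ (f p.1) (g p.2))]
    have h3 : ∀ p ∈ Finset.HasAntidiagonal.antidiagonal n, inner ℂ (f p.1) (g p.2) =
        ((n.factorial : ℂ)⁻¹ * inner ℂ (toFock (Finsupp.single k 1))
          (toFock ((displacementGenerator μ ^ n) (Finsupp.single l 1)))) *
          ((n.choose p.1 : ℂ) * ((-1) ^ p.1 * 1 ^ p.2)) := by
      intro p hp
      rw [Finset.HasAntidiagonal.mem_antidiagonal] at hp
      subst hp
      simp only [hf, hg, inner_smul_left, inner_smul_right, generator_skew_pow]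
      rw [Nat.cast_add_choose]
      have a1 : ((p.1.factorial : ℕ) : ℂ) ≠ 0 := by exact_mod_cast p.1.factorial_ne_zero
      have a2 : ((p.2.factorial : ℕ) : ℂ) ≠ 0 := by exact_mod_cast p.2.factorial_ne_zero
      have a3 : (((p.1 + p.2).factorial : ℕ) : ℂ) ≠ 0 := by
        exact_mod_cast (p.1 + p.2).factorial_ne_zero
      simp only [map_inv₀, map_natCast]
      field_simp
      simp
    rw [Finset.sum_congr rfl h3, ← Finset.mul_sum]
    have h4 := (Commute.all (-1 : ℂ) 1).add_pow' n
    simp only [nsmul_eq_mul] at h4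
    rw [← h4]
    by_cases hn : n = 0
    · subst hn; simp [toFock_single]
    · simp [hn]
  refine (tsum_congr h2).trans ?_
  rw [tsum_ite_eq, ket_inner]

/-- The displacement operator `D(μ) = exp(μ a† - μ* a)`: the isometry sending each number state
`|k⟩` to the exponential series applied to `|k⟩`. -/
noncomputable def displacement (μ : ℂ) : Fock ℕ →L[ℂ] Fock ℕ :=
  (displacedKet_orthonormal μ).orthogonalFamily.linearIsometry.toContinuousLinearMap

theorem displacement_ket (μ : ℂ) (k : ℕ) : displacement μ (ket k) = displacedKet μ k := by
  unfold displacement ket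
  simp

/-! ### Phase-insensitive Gaussian channels -/

/-- The symmetrically ordered characteristic function `χ(μ) = Tr[ρ D(μ)]` of a one-mode
operator. -/
noncomputable def charFn (A : TraceClass ℕ) (μ : ℂ) : ℂ :=
  fockTrace ((A : Fock ℕ →L[ℂ] Fock ℕ) ∘L displacement μ)

/-- `P` is the phase-insensitive Gaussian channel with parameters `τ, ν`, that is, the channel
with `X = diag(√τ, √τ)` and `Y = diag(ν, ν)`:
it acts by `χ'(μ) = χ(√τ μ) exp(-ν |μ|² / 2)`. -/
structure IsPhaseInsensitiveGaussian (τ ν : ℝ) (P : TraceClass ℕ →ₗ[ℂ] TraceClass ℕ) : Prop where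
  channel : IsChannel P
  charFn_apply : ∀ ρ : TraceClass ℕ, IsDensity ρ → ∀ μ : ℂ,
    charFn (P ρ) μ = charFn ρ ((Real.sqrt τ : ℝ) * μ) * ((Real.exp (-(ν * ‖μ‖ ^ 2 / 2)) : ℝ) : ℂ)

/-! ### The photon-number cutoff -/

/-- The strings `a₁, …, aₙ` with `a₁ + ⋯ + aₙ ≤ L`. -/
def cutoffStrings (n L : ℕ) : Finset (Fin n → ℕ) :=
  (Fintype.piFinset fun _ : Fin n => Finset.range (L + 1)).filter fun a => ∑ i, a i ≤ L

/-- The projector `Π_L` onto total photon number at most `L` in `n` modes. -/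
noncomputable def cutoffProjector (n L : ℕ) : Fock (Fin n → ℕ) →L[ℂ] Fock (Fin n → ℕ) :=
  ∑ a ∈ cutoffStrings n L, InnerProductSpace.rankOne ℂ (ket a) (ket a)

/-- `Tr{Π_L ρ}`, the weight of `ρ` on total photon number at most `L`. -/
noncomputable def cutoffWeight {n : ℕ} (L : ℕ) (ρ : TraceClass (Fin n → ℕ)) : ℝ :=
  (fockTrace (cutoffProjector n L ∘L (ρ : Fock (Fin n → ℕ) →L[ℂ] Fock (Fin n → ℕ)))).re

/-! ### Matrix elements of the displacement operator -/

/-! The channel commutes with phase rotations, so the photon-number distribution of its output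
depends only on that of its input. For number-state inputs the output numbers of the modes are
independent with explicit laws, and a law-of-large-numbers estimate applies. Superpositions and
weight above the input cutoff are handled by a gentle-measurement argument.

One mode. Averaging the characteristic function of `P (|a⟩⟨b|)` over the circle `|μ|² = x` leaves
only its number-diagonal, weighted by the Laguerre functions `⟨k|D(μ)|k⟩ = exp(-x/2) L_k(x)`. The
channel relation evaluates the same average: it is zero for `a ≠ b`. A Laplace transform in `x`
turns Laguerre functions into powers (`laplace_displacementDiag`). This gives the generating
function of the output number in closed form (`hasSum_generating`) and shows that coherences
contribute nothing to the output diagonal (`element_offDiagonal`).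

Many modes. Write `κ = (τ + ν - 1)/2`. For `|a₁, …, aₙ⟩` with `∑ aᵢ ≤ ⌈nN⌉`, let `X` be the total
output number and `z = 1 - 1/n`. The mean of `z ^ X` is at least about `exp(-(τN + κ))`, and its
relative variance is at most `exp(C/n) - 1`. Chebyshev's inequality for `z ^ X` then bounds the
probability that `X` exceeds `n(τN + κ + δ)` by `O(1/n)` (`cutoff_sum_ge_of_outputGenerating`).

General input. With `Π` the input cutoff and `Π' = 1 - Π`, `ρ = CρC + (1 - r²) ΠρΠ + (1 - r⁻²)
Π'ρΠ'`, where `C = rΠ + r⁻¹Π'`. The first term is positive and can be dropped, the second reduces to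
number states, and the third has trace `q = 1 - Tr(Πρ)`. Taking `r² = √q` costs `2√q`
(`IsChannel.diagonalWeight_ge`). -/

theorem annihilation_single (k : ℕ) (c : ℂ) :
    annihilation (Finsupp.single k c) = Finsupp.single (k - 1) (c * (Real.sqrt k : ℝ)) := by
  simp [annihilation]

theorem creation_single (k : ℕ) (c : ℂ) :
    creation (Finsupp.single k c) = Finsupp.single (k + 1) (c * (Real.sqrt (k + 1) : ℝ)) := by
  simp [creation]

theorem ofReal_sqrt_mul_self {x : ℝ} (hx : 0 ≤ x) :
    ((Real.sqrt x : ℝ) : ℂ) * ((Real.sqrt x : ℝ) : ℂ) = (x : ℂ) := by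
  rw [← Complex.ofReal_mul, Real.mul_self_sqrt hx]

theorem annihilation_creation : annihilation * creation = creation * annihilation + 1 := by
  refine Finsupp.lhom_ext fun k c => ?_
  simp only [Module.End.mul_apply, LinearMap.add_apply, Module.End.one_apply,
    annihilation_single, creation_single, Nat.add_sub_cancel]
  rcases k with _ | k
  · simp
  · simp only [Nat.add_sub_cancel, ← Finsupp.single_add]
    congr 1
    have h := ofReal_sqrt_mul_self (x := (k : ℝ) + 1) (by positivity)
    have h' := ofReal_sqrt_mul_self (x := (k : ℝ) + 1 + 1) (by positivity)
    push_cast at *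
    rw [mul_assoc, mul_assoc, h, h']
    ring

theorem lowering_mul_generator {R : Type*} [Ring R] [Algebra ℂ R] {A C : R}
    (h : A * C = C * A + 1) (μ c : ℂ) :
    A * (μ • C - c • A) = (μ • C - c • A) * A + μ • 1 := by
  simp only [mul_sub, sub_mul, mul_smul_comm, smul_mul_assoc, h, smul_add]
  abel

theorem raising_mul_generator {R : Type*} [Ring R] [Algebra ℂ R] {A C : R}
    (h : A * C = C * A + 1) (μ c : ℂ) :
    C * (μ • C - c • A) = (μ • C - c • A) * C + c • 1 := by
  simp only [mul_sub, sub_mul, mul_smul_comm, smul_mul_assoc, h, smul_add]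
  abel

theorem annihilation_generator (μ : ℂ) :
    annihilation * displacementGenerator μ =
      displacementGenerator μ * annihilation + μ • 1 :=
  lowering_mul_generator (R := Module.End ℂ (ℕ →₀ ℂ)) annihilation_creation μ (starRingEnd ℂ μ)

theorem creation_generator (μ : ℂ) :
    creation * displacementGenerator μ =
      displacementGenerator μ * creation + (starRingEnd ℂ μ) • 1 :=
  raising_mul_generator (R := Module.End ℂ (ℕ →₀ ℂ)) annihilation_creation μ (starRingEnd ℂ μ)

/-- A commutator `[T, G] = c` that is a scalar acts as a derivation on powers of `G`. Divided by `(m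
+ 1)!`, this is the order `m + 1` part of `T exp G = exp G (T + c)`. Working order by order stays on
finite superpositions, where these unbounded operators are defined. -/
theorem mul_pow_succ_of_mul_eq {R : Type*} [Ring R] [Algebra ℂ R] {T G : R} {c : ℂ}
    (h : T * G = G * T + c • 1) (m : ℕ) :
    T * G ^ (m + 1) = G ^ (m + 1) * T + (((m : ℂ) + 1) * c) • G ^ m := by
  induction m with
  | zero => simpa using h
  | succ m ih =>
    rw [pow_succ, ← mul_assoc, ih, add_mul, mul_assoc, h, mul_add, ← mul_assoc, ← pow_succ,
      smul_mul_assoc, ← pow_succ, add_assoc, mul_smul_comm, mul_one, ← add_smul]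
    push_cast
    congr 2
    ring

theorem annihilation_apply (v : ℕ →₀ ℂ) (j : ℕ) :
    annihilation v j = (Real.sqrt (j + 1) : ℝ) * v (j + 1) := by
  induction v using Finsupp.induction_linear with
  | zero => simp
  | add f g hf hg => simp only [map_add, Finsupp.add_apply, hf, hg]; ring
  | single k c =>
    rw [annihilation_single, Finsupp.single_apply, Finsupp.single_apply]
    rcases k with _ | k
    · simp
    · by_cases h : k = j
      · subst h; simp [mul_comm]
      · simp [h]

theorem creation_apply_zero (v : ℕ →₀ ℂ) : creation v 0 = 0 := by
  induction v using Finsupp.induction_linear with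
  | zero => simp
  | add f g hf hg => simp only [map_add, Finsupp.add_apply, hf, hg]; ring
  | single k c => simp [creation_single]

theorem generator_apply_zero (μ : ℂ) (v : ℕ →₀ ℂ) :
    displacementGenerator μ v 0 = - (starRingEnd ℂ μ) * annihilation v 0 := by
  simp [displacementGenerator, creation_apply_zero]

/-- `⟨j|(μ a† - μ* a)ᵐ|k⟩ / m!`. -/
noncomputable def expCoeff (μ : ℂ) (j k m : ℕ) : ℂ :=
  (m.factorial : ℂ)⁻¹ * ((displacementGenerator μ ^ m) (Finsupp.single k 1)) j

theorem inner_ket_toFock (j : ℕ) (v : ℕ →₀ ℂ) : inner ℂ (ket j) (toFock v) = v j := by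
  induction v using Finsupp.induction_linear with
  | zero => simp
  | add f g hf hg => simp only [map_add, Finsupp.add_apply, inner_add_right, hf, hg]
  | single k c =>
    rw [toFock_single, inner_smul_right, ket_inner, Finsupp.single_apply]
    by_cases h : j = k
    · simp [h]
    · simp [h, Ne.symm h]

/-- `⟨j|D(μ)|k⟩`. -/
noncomputable def displacementElement (μ : ℂ) (j k : ℕ) : ℂ :=
  inner ℂ (ket j) (displacedKet μ k)

theorem hasSum_expCoeff (μ : ℂ) (j k : ℕ) :
    HasSum (expCoeff μ j k) (displacementElement μ j k) := by
  have h := (displacedKet_summable_norm μ k).of_norm.hasSum.mapL (innerSL ℂ (ket j))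
  simp only [map_smul, innerSL_apply_apply, inner_ket_toFock] at h
  exact h

/-- Order `m + 1` of `a D(μ) = D(μ) (a + μ)` between `⟨j|` and `|k⟩`. The truncated `k - 1` is
harmless at `k = 0` because its coefficient is `√0`. -/
theorem expCoeff_annihilation (μ : ℂ) (j k m : ℕ) :
    (Real.sqrt (j + 1) : ℝ) * expCoeff μ (j + 1) k (m + 1) =
      (Real.sqrt k : ℝ) * expCoeff μ j (k - 1) (m + 1) + μ * expCoeff μ j k m := by
  have h := congrArg (fun T : Module.End ℂ (ℕ →₀ ℂ) => T (Finsupp.single k 1) j)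
    (mul_pow_succ_of_mul_eq (annihilation_generator μ) m)
  simp only [Module.End.mul_apply, LinearMap.add_apply, LinearMap.smul_apply, Finsupp.add_apply,
    Finsupp.smul_apply, annihilation_apply, annihilation_single, one_mul, smul_eq_mul] at h
  have e : (Finsupp.single (k - 1) ((Real.sqrt k : ℝ) : ℂ) : ℕ →₀ ℂ) =
      ((Real.sqrt k : ℝ) : ℂ) • Finsupp.single (k - 1) 1 := by simp
  rw [e, map_smul, Finsupp.smul_apply, smul_eq_mul] at h
  have hm : (m : ℂ) + 1 ≠ 0 := by exact_mod_cast m.succ_ne_zero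
  have hf : (m.factorial : ℂ) ≠ 0 := by exact_mod_cast m.factorial_ne_zero
  simp only [expCoeff, Nat.factorial_succ, Nat.cast_mul, Nat.cast_succ]
  rw [mul_left_comm, h]
  field_simp

theorem expCoeff_creation (μ : ℂ) (k m : ℕ) :
    (Real.sqrt (k + 1) : ℝ) * expCoeff μ 0 (k + 1) (m + 1) =
      - (starRingEnd ℂ μ) * expCoeff μ 0 k m := by
  have h := congrArg (fun T : Module.End ℂ (ℕ →₀ ℂ) => T (Finsupp.single k 1) 0)
    (mul_pow_succ_of_mul_eq (creation_generator μ) m)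
  simp only [Module.End.mul_apply, LinearMap.add_apply, LinearMap.smul_apply, Finsupp.add_apply,
    Finsupp.smul_apply, creation_apply_zero, creation_single, one_mul, smul_eq_mul] at h
  have e : (Finsupp.single (k + 1) ((Real.sqrt (k + 1) : ℝ) : ℂ) : ℕ →₀ ℂ) =
      ((Real.sqrt (k + 1) : ℝ) : ℂ) • Finsupp.single (k + 1) 1 := by simp
  rw [e, map_smul, Finsupp.smul_apply, smul_eq_mul] at h
  have hm : (m : ℂ) + 1 ≠ 0 := by exact_mod_cast m.succ_ne_zero
  have hf : (m.factorial : ℂ) ≠ 0 := by exact_mod_cast m.factorial_ne_zero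
  simp only [expCoeff, Nat.factorial_succ, Nat.cast_mul, Nat.cast_succ]
  rw [mul_left_comm, eq_neg_of_add_eq_zero_left h.symm]
  field_simp

theorem expCoeff_zero_order (μ : ℂ) (j k : ℕ) : expCoeff μ j k 0 = if j = k then 1 else 0 := by
  simp [expCoeff, Finsupp.single_apply, eq_comm]

theorem displacementElement_annihilation (μ : ℂ) (j k : ℕ) :
    (Real.sqrt (j + 1) : ℝ) * displacementElement μ (j + 1) k =
      (Real.sqrt k : ℝ) * displacementElement μ j (k - 1) + μ * displacementElement μ j k := by
  have h1 := (hasSum_nat_add_iff' 1).mpr ((hasSum_expCoeff μ (j + 1) k).mul_left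
    ((Real.sqrt (j + 1) : ℝ) : ℂ))
  have h2 := ((hasSum_nat_add_iff' 1).mpr ((hasSum_expCoeff μ j (k - 1)).mul_left
    ((Real.sqrt k : ℝ) : ℂ))).add ((hasSum_expCoeff μ j k).mul_left μ)
  simp only [expCoeff_annihilation] at h1
  have h3 := h1.unique h2
  simp only [Finset.sum_range_one, expCoeff_zero_order] at h3
  -- The recursion relates order `m + 1` to order `m`, so the order-zero terms, split off above, are
  -- matched separately: both sides are `⟨j|a|k⟩`.
  have h4 : ((Real.sqrt (j + 1) : ℝ) : ℂ) * (if j + 1 = k then 1 else 0) =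
      ((Real.sqrt k : ℝ) : ℂ) * (if j = k - 1 then 1 else 0) := by
    rcases k with _ | k
    · simp
    · by_cases h : j = k <;> simp [h]
  rw [h4] at h3
  linear_combination h3

theorem displacementElement_creation (μ : ℂ) (k : ℕ) :
    (Real.sqrt (k + 1) : ℝ) * displacementElement μ 0 (k + 1) =
      - (starRingEnd ℂ μ) * displacementElement μ 0 k := by
  have h1 := (hasSum_nat_add_iff' 1).mpr ((hasSum_expCoeff μ 0 (k + 1)).mul_left
    ((Real.sqrt (k + 1) : ℝ) : ℂ))
  have h2 := (hasSum_expCoeff μ 0 k).mul_left (- (starRingEnd ℂ μ))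
  simp only [expCoeff_creation] at h1
  have h3 := h1.unique h2
  simpa [expCoeff_zero_order] using h3

/-- The vacuum component of `G v` is `-μ*` times the one-photon component of `v`, and the
annihilation recursion returns from one photon to the vacuum with factor `μ`. Hence even orders
build the series of `exp(-|μ|²/2)` and odd orders vanish. -/
theorem expCoeff_vacuum (μ : ℂ) (m : ℕ) :
    expCoeff μ 0 0 (m + 2) = - ((‖μ‖ ^ 2 : ℝ) : ℂ) / (m + 2) * expCoeff μ 0 0 m := by
  have h := expCoeff_annihilation μ 0 0 m
  simp only [Nat.cast_zero, zero_add, Real.sqrt_one, Real.sqrt_zero, Complex.ofReal_one, one_mul,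
    Complex.ofReal_zero, zero_mul] at h
  have e : expCoeff μ 0 0 (m + 2) = (((m : ℂ) + 2)⁻¹) * (- starRingEnd ℂ μ * expCoeff μ 1 0 (m + 1)) := by
    simp only [expCoeff]
    rw [show m + 2 = (m + 1) + 1 by ring, pow_succ', Module.End.mul_apply, generator_apply_zero,
      annihilation_apply, Nat.factorial_succ]
    push_cast
    simp only [zero_add, Real.sqrt_one, Complex.ofReal_one, one_mul]
    rw [mul_inv]
    ring
  rw [e, h]
  have h2 : starRingEnd ℂ μ * μ = ((‖μ‖ ^ 2 : ℝ) : ℂ) := by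
    rw [Complex.conj_mul']; push_cast; rfl
  rw [← h2]
  ring

theorem displacementElement_vacuum (μ : ℂ) :
    displacementElement μ 0 0 = ((Real.exp (-(‖μ‖ ^ 2 / 2)) : ℝ) : ℂ) := by
  have he : ∀ t : ℕ, expCoeff μ 0 0 (2 * t) =
      ((t.factorial : ℂ)⁻¹) * ((-(‖μ‖ ^ 2 / 2) : ℝ) : ℂ) ^ t := by
    intro t
    induction t with
    | zero => simp [expCoeff_zero_order]
    | succ t ih =>
      rw [show 2 * (t + 1) = 2 * t + 2 by ring, expCoeff_vacuum, ih, Nat.factorial_succ]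
      have hm : (t : ℂ) + 1 ≠ 0 := by exact_mod_cast t.succ_ne_zero
      have hm' : ((2 * t : ℕ) : ℂ) + 2 ≠ 0 := by exact_mod_cast (by omega : 2 * t + 2 ≠ 0)
      have hf : (t.factorial : ℂ) ≠ 0 := by exact_mod_cast t.factorial_ne_zero
      push_cast at *
      have : (2 * (t : ℂ) + 2) = 2 * (t + 1) := by ring
      rw [this]
      field_simp
      ring
  have ho : ∀ t : ℕ, expCoeff μ 0 0 (2 * t + 1) = 0 := by
    intro t
    induction t with
    | zero => simp [expCoeff, generator_apply_zero, annihilation_single]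
    | succ t ih =>
      rw [show 2 * (t + 1) + 1 = 2 * t + 1 + 2 by ring, expCoeff_vacuum, ih, mul_zero]
  have h1 : HasSum (fun t => expCoeff μ 0 0 (2 * t))
      ((Real.exp (-(‖μ‖ ^ 2 / 2)) : ℝ) : ℂ) := by
    simp only [he]
    rw [Complex.ofReal_exp, Complex.exp_eq_exp_ℂ]
    have := NormedSpace.exp_series_hasSum_exp' (𝕂 := ℂ) (((-(‖μ‖ ^ 2 / 2) : ℝ) : ℂ))
    simpa using this
  have h2 : HasSum (fun t => expCoeff μ 0 0 (2 * t + 1)) 0 := by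
    simp only [ho]; exact hasSum_zero
  have := h1.even_add_odd h2
  rw [add_zero] at this
  exact (hasSum_expCoeff μ 0 0).unique this

/-- `√(j! k!) ⟨j|D(μ)|k⟩ exp(|μ|²/2)` as a polynomial in `μ` and `μ*`. -/
noncomputable def displacementPoly (μ : ℂ) (j k : ℕ) : ℂ :=
  ∑ q ∈ Finset.range (j + 1), (j.choose q : ℂ) * (k.descFactorial q : ℂ) *
    μ ^ (j - q) * (- starRingEnd ℂ μ) ^ (k - q)

/-- Pascal's rule for `(j + 1).choose q` splits the sum into the two terms of the recursion
satisfied by the matrix elements. -/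
theorem displacementPoly_succ (μ : ℂ) (j k : ℕ) :
    displacementPoly μ (j + 1) k =
      k * displacementPoly μ j (k - 1) + μ * displacementPoly μ j k := by
  have hl : displacementPoly μ (j + 1) k =
      (∑ q ∈ Finset.range (j + 1), (j.choose q : ℂ) * (k.descFactorial (q + 1) : ℂ) *
        μ ^ (j - q) * (- starRingEnd ℂ μ) ^ (k - (q + 1))) +
      (∑ q ∈ Finset.range (j + 1 + 1), (j.choose q : ℂ) * (k.descFactorial q : ℂ) *
        μ ^ (j + 1 - q) * (- starRingEnd ℂ μ) ^ (k - q)) := by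
    rw [displacementPoly, Finset.sum_range_succ', Finset.sum_range_succ' _ (j + 1), ← add_assoc,
      ← Finset.sum_add_distrib]
    congr 1
    · refine Finset.sum_congr rfl fun q _ => ?_
      rw [Nat.choose_succ_succ, Nat.add_sub_add_right]
      push_cast
      ring
    · simp
  rw [hl]
  congr 1
  · rw [displacementPoly, Finset.mul_sum]
    refine Finset.sum_congr rfl fun q _ => ?_
    rcases k with _ | k
    · simp
    · rw [Nat.succ_descFactorial_succ, Nat.add_sub_cancel, Nat.add_sub_add_right]
      push_cast
      ring
  · rw [Finset.sum_range_succ, Nat.choose_succ_self, displacementPoly, Finset.mul_sum]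
    simp only [Nat.cast_zero, zero_mul, add_zero]
    refine Finset.sum_congr rfl fun q hq => ?_
    have : j + 1 - q = (j - q) + 1 := by
      have := Finset.mem_range.mp hq; omega
    rw [this, pow_succ]
    ring

theorem sqrt_factorial_succ (j : ℕ) :
    ((Real.sqrt (j + 1).factorial : ℝ) : ℂ) =
      (Real.sqrt (j + 1) : ℝ) * (Real.sqrt j.factorial : ℝ) := by
  rw [← Complex.ofReal_mul, ← Real.sqrt_mul (by positivity), Nat.factorial_succ]
  push_cast
  rfl

theorem displacementElement_eq (μ : ℂ) (j k : ℕ) :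
    ((Real.sqrt j.factorial : ℝ) : ℂ) * (Real.sqrt k.factorial : ℝ) * displacementElement μ j k =
      (Real.exp (-(‖μ‖ ^ 2 / 2)) : ℝ) * displacementPoly μ j k := by
  induction j generalizing k with
  | zero =>
    have e : ∀ k, displacementPoly μ 0 k = (- starRingEnd ℂ μ) ^ k := by
      intro k; simp [displacementPoly]
    rw [e]
    induction k with
    | zero => simp [displacementElement_vacuum]
    | succ k ih =>
      have h := displacementElement_creation μ k
      rw [sqrt_factorial_succ, pow_succ (- starRingEnd ℂ μ)]
      linear_combination ((Real.sqrt (Nat.factorial 0) : ℝ) : ℂ) *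
        (Real.sqrt k.factorial : ℝ) * h - starRingEnd ℂ μ * ih
  | succ j ih =>
    have h := displacementElement_annihilation μ j k
    rw [sqrt_factorial_succ, displacementPoly_succ]
    have hk : ((Real.sqrt k.factorial : ℝ) : ℂ) * (Real.sqrt k : ℝ) * displacementElement μ j (k - 1)
        = k * ((Real.sqrt (k - 1).factorial : ℝ) : ℂ) * displacementElement μ j (k - 1) := by
      rcases k with _ | k
      · simp
      · rw [sqrt_factorial_succ, Nat.add_sub_cancel]
        have h := ofReal_sqrt_mul_self (x := (k : ℝ) + 1) (by positivity)
        push_cast at *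
        linear_combination ((Real.sqrt k.factorial : ℝ) : ℂ) * displacementElement μ j k * h
    linear_combination ((Real.sqrt j.factorial : ℝ) : ℂ) * (Real.sqrt k.factorial : ℝ) * h +
      ((Real.sqrt j.factorial : ℝ) : ℂ) * hk + k * ih (k - 1) + μ * ih k

/-- Each monomial `μ^(j-q) (μ*)^(k-q)` picks up the same phase `u^(j-k)`. Keeping `u ^ k` on the
left avoids negative exponents. -/
theorem displacementElement_rotate {u : ℂ} (hu : ‖u‖ = 1) (r : ℝ) (j k : ℕ) :
    u ^ k * displacementElement (r * u) j k = u ^ j * displacementElement r j k := by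
  have hp : u ^ k * displacementPoly (r * u) j k = u ^ j * displacementPoly r j k := by
    have huu : starRingEnd ℂ u * u = 1 := by rw [Complex.conj_mul', hu]; simp
    rw [displacementPoly, displacementPoly, Finset.mul_sum, Finset.mul_sum]
    refine Finset.sum_congr rfl fun q hq => ?_
    rcases le_or_gt q k with h | h
    · have hj : u ^ j = u ^ (j - q) * u ^ q := by
        rw [← pow_add, Nat.sub_add_cancel (by have := Finset.mem_range.mp hq; omega)]
      have hk : u ^ k * (starRingEnd ℂ u) ^ (k - q) = u ^ q := by
        conv_lhs => rw [← Nat.sub_add_cancel h, pow_add, Nat.add_sub_cancel]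
        rw [mul_right_comm, ← mul_pow, mul_comm u, huu, one_pow, one_mul]
      rw [hj]
      simp only [map_mul, Complex.conj_ofReal, ← neg_mul, mul_pow, ← hk]
      ring
    -- For `q > k` the truncated exponent would spoil the phase count, but the falling factorial
    -- vanishes.
    · simp [Nat.descFactorial_eq_zero_iff_lt.mpr h]
  have h1 := displacementElement_eq (r * u) j k
  have h2 := displacementElement_eq r j k
  rw [norm_mul, hu, mul_one] at h1
  have hj : ((Real.sqrt j.factorial : ℝ) : ℂ) ≠ 0 := by
    exact_mod_cast (Real.sqrt_pos.mpr (by positivity)).ne'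
  have hk : ((Real.sqrt k.factorial : ℝ) : ℂ) ≠ 0 := by
    exact_mod_cast (Real.sqrt_pos.mpr (by positivity)).ne'
  apply mul_left_cancel₀ (mul_ne_zero hj hk)
  linear_combination u ^ k * h1 - u ^ j * h2 + (Real.exp (-(‖(r : ℂ)‖ ^ 2 / 2)) : ℝ) * hp

/-- `⟨k|D(μ)|k⟩` for `|μ|² = x`. -/
noncomputable def displacementDiag (k : ℕ) (x : ℝ) : ℝ :=
  Real.exp (-(x / 2)) * ∑ q ∈ Finset.range (k + 1),
    (k.choose q : ℝ) * (((k - q).factorial : ℝ)⁻¹ * (-x) ^ (k - q))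

/-- The sum in `displacementDiag` is the Laguerre polynomial `L_k(x)`, indexed by `k - q`. -/
theorem displacementElement_self (r : ℝ) (k : ℕ) :
    displacementElement r k k = displacementDiag k (r ^ 2) := by
  have h := displacementElement_eq r k k
  rw [ofReal_sqrt_mul_self (by positivity)] at h
  have hk : (k.factorial : ℂ) ≠ 0 := by exact_mod_cast k.factorial_ne_zero
  apply mul_left_cancel₀ hk
  push_cast at h
  rw [h, displacementDiag, displacementPoly]
  push_cast
  rw [mul_left_comm, Complex.norm_real, Real.norm_eq_abs, ← Complex.ofReal_pow, sq_abs]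
  congr 1
  · simp
  rw [Finset.mul_sum]
  refine Finset.sum_congr rfl fun q hq => ?_
  have hq' : q ≤ k := by have := Finset.mem_range.mp hq; omega
  have h2 := Nat.factorial_mul_descFactorial hq'
  have hf : ((k - q).factorial : ℂ) ≠ 0 := by exact_mod_cast (k - q).factorial_ne_zero
  rw [← h2, Complex.conj_ofReal]
  push_cast
  field_simp
  rw [mul_assoc, ← mul_pow]
  ring

section

open MeasureTheory
open scoped ComplexOrder

/-! ### Trace-class operators -/

theorem traceClass_induction {ι : Type} [DecidableEq ι] {p : TraceClass ι → Prop}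
    (pos : ∀ A : TraceClass ι, (A : Fock ι →L[ℂ] Fock ι).IsPositive →
      (Summable fun a : ι => inner ℂ (ket a) ((A : Fock ι →L[ℂ] Fock ι) (ket a))) → p A)
    (add : ∀ A B, p A → p B → p (A + B)) (smul : ∀ (c : ℂ) A, p A → p (c • A))
    (A : TraceClass ι) : p A := by
  obtain ⟨A, hA⟩ := A
  unfold TraceClass at hA
  induction hA using Submodule.span_induction with
  | mem A h => exact pos ⟨A, Submodule.subset_span h⟩ h.1 h.2
  | zero => exact pos 0 (by simp) (by simp)
  | add A B hA hB h1 h2 => exact add ⟨A, hA⟩ ⟨B, hB⟩ h1 h2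
  | smul c A hA h => exact smul c ⟨A, hA⟩ h

theorem inner_ket_left {ι : Type} [DecidableEq ι] (a : ι) (v : Fock ι) :
    inner ℂ (ket a) v = v a := by
  unfold ket
  rw [lp.inner_single_left]
  simp

theorem inner_ket_ket {ι : Type} [DecidableEq ι] (a b : ι) :
    inner ℂ (ket a) (ket b) = if a = b then (1 : ℂ) else 0 := by
  rw [inner_ket_left]
  unfold ket
  rw [lp.single_apply]
  by_cases h : a = b
  · subst h; simp
  · simp [h]

theorem hasSum_norm_sq_apply {ι : Type} (v : Fock ι) :
    HasSum (fun a => ‖v a‖ ^ 2) (‖v‖ ^ 2) := by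
  have h := (lp.hasSum_inner v v).mapL Complex.reCLM
  have e : ∀ z : ℂ, (inner ℂ z z).re = ‖z‖ ^ 2 := fun z => inner_self_eq_norm_sq (𝕜 := ℂ) z
  have e' : (inner ℂ v v).re = ‖v‖ ^ 2 := inner_self_eq_norm_sq (𝕜 := ℂ) v
  simpa only [Complex.reCLM_apply, e, e'] using h

/-- The matrix element `⟨a|A|b⟩`. -/
noncomputable def element {ι : Type} [DecidableEq ι] (A : TraceClass ι) (a b : ι) : ℂ :=
  inner ℂ (ket a) ((A : Fock ι →L[ℂ] Fock ι) (ket b))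

theorem element_add {ι : Type} [DecidableEq ι] (A B : TraceClass ι) (a b : ι) :
    element (A + B) a b = element A a b + element B a b := by
  simp [element]

theorem element_smul {ι : Type} [DecidableEq ι] (c : ℂ) (A : TraceClass ι) (a b : ι) :
    element (c • A) a b = c * element A a b := by
  simp [element]

theorem element_sum {ι κ : Type} [DecidableEq ι] (s : Finset κ) (A : κ → TraceClass ι) (a b : ι) :
    element (∑ i ∈ s, A i) a b = ∑ i ∈ s, element (A i) a b := by
  classical
  induction s using Finset.induction_on with
  | empty => simp [element]
  | insert i s hi ih => rw [Finset.sum_insert hi, Finset.sum_insert hi, element_add, ih]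

theorem element_nonneg {ι : Type} [DecidableEq ι] {A : TraceClass ι}
    (hA : (A : Fock ι →L[ℂ] Fock ι).IsPositive) (a : ι) : 0 ≤ element A a a :=
  hA.inner_nonneg_right _

theorem exists_symmetric_sqrt {H : Type*} [NormedAddCommGroup H] [InnerProductSpace ℂ H]
    [CompleteSpace H] {B : H →L[ℂ] H} (hB : B.IsPositive) :
    ∃ S : H →L[ℂ] H, (∀ u v, inner ℂ (S u) v = inner ℂ u (S v)) ∧ ∀ v, B v = S (S v) := by
  have hB0 : 0 ≤ B := (ContinuousLinearMap.nonneg_iff_isPositive B).mpr hB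
  have hS : (CFC.sqrt B).IsPositive :=
    (ContinuousLinearMap.nonneg_iff_isPositive _).mp (CFC.sqrt_nonneg B)
  refine ⟨CFC.sqrt B, fun u v => hS.inner_left_eq_inner_right u v, fun v => ?_⟩
  conv_lhs => rw [← CFC.sqrt_mul_sqrt_self B hB0]
  rfl

/-- Hilbert–Schmidt sums in another orthonormal system: expand `S e_k` in number states, move `S`
across by symmetry, and apply Bessel's inequality to each `S|a⟩`. -/
theorem sum_norm_sq_orthonormal_le {ι : Type} [DecidableEq ι] {S : Fock ι →L[ℂ] Fock ι}
    (hS : ∀ u v, inner ℂ (S u) v = inner ℂ u (S v)) (hs : Summable fun a => ‖S (ket a)‖ ^ 2)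
    {κ : Type} {e : κ → Fock ι} (he : Orthonormal ℂ e) (F : Finset κ) :
    ∑ k ∈ F, ‖S (e k)‖ ^ 2 ≤ ∑' a, ‖S (ket a)‖ ^ 2 := by
  have h1 : HasSum (fun a => ∑ k ∈ F, ‖(S (e k)) a‖ ^ 2) (∑ k ∈ F, ‖S (e k)‖ ^ 2) :=
    hasSum_sum fun k _ => hasSum_norm_sq_apply _
  refine hasSum_le (fun a => ?_) h1 hs.hasSum
  refine le_trans (le_of_eq ?_) (he.sum_inner_products_le (s := F) (S (ket a)))
  refine Finset.sum_congr rfl fun k _ => ?_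
  rw [← inner_ket_left, ← hS, norm_inner_symm]

/-- The diagonal of a positive trace-class operator with respect to a pair of orthonormal systems,
one of them the number states, is absolutely summable. -/
theorem sum_norm_inner_le {B : Fock ℕ →L[ℂ] Fock ℕ} (hB : B.IsPositive)
    (hs : Summable fun a : ℕ => inner ℂ (ket a) (B (ket a))) {e : ℕ → Fock ℕ}
    (he : Orthonormal ℂ e) (F : Finset ℕ) :
    ∑ k ∈ F, ‖inner ℂ (ket k) (B (e k))‖ ≤ ∑' a, ‖inner ℂ (ket a) (B (ket a))‖ := by
  obtain ⟨S, hS, hBS⟩ := exists_symmetric_sqrt hB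
  have e1 : ∀ a : ℕ, ‖inner ℂ (ket a) (B (ket a))‖ = ‖S (ket a)‖ ^ 2 := by
    intro a
    rw [hBS, ← hS, inner_self_eq_norm_sq_to_K]
    simp
  have hs' : Summable fun a : ℕ => ‖S (ket a)‖ ^ 2 := by
    simpa only [e1] using hs.norm
  simp only [e1]
  have hket : Orthonormal ℂ (fun k : ℕ => (ket k : Fock ℕ)) := by
    rw [orthonormal_iff_ite]; intro i j; exact inner_ket_ket i j
  have b1 := sum_norm_sq_orthonormal_le hS hs' he F
  have b2 := sum_norm_sq_orthonormal_le hS hs' hket F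
  -- With `B = S²`, Cauchy–Schwarz and the arithmetic-geometric mean inequality reduce each term to
  -- the two Hilbert–Schmidt sums.
  have b3 : ∀ k ∈ F, ‖inner ℂ (ket k) (B (e k))‖ ≤
      (‖S (ket k)‖ ^ 2 + ‖S (e k)‖ ^ 2) / 2 := by
    intro k _
    rw [hBS, ← hS]
    refine (norm_inner_le_norm _ _).trans ?_
    nlinarith [sq_nonneg (‖S (ket k)‖ - ‖S (e k)‖)]
  refine (Finset.sum_le_sum b3).trans ?_
  rw [← Finset.sum_div, Finset.sum_add_distrib]
  linarith

theorem summable_element {ι : Type} [DecidableEq ι] (A : TraceClass ι) :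
    Summable fun a => element A a a := by
  induction A using traceClass_induction with
  | pos A _ h => exact h
  | add A B h1 h2 => simpa only [element_add] using h1.add h2
  | smul c A h => simpa only [element_smul] using h.mul_left c

theorem summable_norm_inner_orthonormal (A : TraceClass ℕ) {e : ℕ → Fock ℕ}
    (he : Orthonormal ℂ e) :
    Summable fun k => ‖inner ℂ (ket k) ((A : Fock ℕ →L[ℂ] Fock ℕ) (e k))‖ := by
  induction A using traceClass_induction with
  | pos A h hs => exact summable_of_sum_le (fun _ => norm_nonneg _) (sum_norm_inner_le h hs he)
  | add A B h1 h2 =>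
    simp only [Submodule.coe_add, add_apply, inner_add_right]
    exact (h1.of_norm.add h2.of_norm).norm
  | smul c A h =>
    simp only [Submodule.coe_smul, smul_apply, inner_smul_right]
    exact (h.of_norm.mul_left c).norm

theorem charFn_eq_tsum (A : TraceClass ℕ) (μ : ℂ) :
    charFn A μ = ∑' k, inner ℂ (ket k) ((A : Fock ℕ →L[ℂ] Fock ℕ) (displacedKet μ k)) := by
  simp [charFn, fockTrace, displacement_ket]

theorem charFn_hasSum (A : TraceClass ℕ) (μ : ℂ) :
    HasSum (fun k => inner ℂ (ket k) ((A : Fock ℕ →L[ℂ] Fock ℕ) (displacedKet μ k)))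
      (charFn A μ) := by
  rw [charFn_eq_tsum]
  exact (summable_norm_inner_orthonormal A (displacedKet_orthonormal μ)).of_norm.hasSum

theorem charFn_add (A B : TraceClass ℕ) (μ : ℂ) :
    charFn (A + B) μ = charFn A μ + charFn B μ := by
  refine (charFn_hasSum (A + B) μ).unique ?_
  simpa [inner_add_right] using (charFn_hasSum A μ).add (charFn_hasSum B μ)

theorem charFn_smul (c : ℂ) (A : TraceClass ℕ) (μ : ℂ) :
    charFn (c • A) μ = c * charFn A μ := by
  refine (charFn_hasSum (c • A) μ).unique ?_
  simpa [inner_smul_right] using (charFn_hasSum A μ).mul_left c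

theorem rankOne_self_mem_traceClass {ι : Type} [DecidableEq ι] (u : Fock ι) :
    InnerProductSpace.rankOne ℂ u u ∈ TraceClass ι := by
  refine Submodule.subset_span ⟨InnerProductSpace.isPositive_rankOne_self u, ?_⟩
  have h := (hasSum_norm_sq_apply u).summable.mapL Complex.ofRealCLM
  convert h using 2 with a
  rw [InnerProductSpace.rankOne_apply, inner_smul_right, inner_ket_left, ← inner_conj_symm,
    inner_ket_left, Complex.conj_mul']
  simp

/-- Polarization writes the operator as a combination of positive rank-one operators. -/
theorem rankOne_mem_traceClass {ι : Type} [DecidableEq ι] (u v : Fock ι) :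
    InnerProductSpace.rankOne ℂ u v ∈ TraceClass ι := by
  have h : InnerProductSpace.rankOne ℂ u v = (4 : ℂ)⁻¹ •
      (InnerProductSpace.rankOne ℂ (u + v) (u + v) - InnerProductSpace.rankOne ℂ (u - v) (u - v) +
      Complex.I • (InnerProductSpace.rankOne ℂ (u + Complex.I • v) (u + Complex.I • v) -
        InnerProductSpace.rankOne ℂ (u - Complex.I • v) (u - Complex.I • v))) := by
    ext1 w
    simp only [InnerProductSpace.rankOne_apply, smul_apply,
      add_apply, sub_apply, inner_add_left, inner_sub_left,
      inner_smul_left, Complex.conj_I]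
    match_scalars <;> ring_nf <;> simp only [Complex.I_sq] <;> ring_nf
  rw [h]
  have m := fun u : Fock ι => rankOne_self_mem_traceClass u
  exact Submodule.smul_mem _ _ (Submodule.add_mem _ (Submodule.sub_mem _ (m _) (m _))
    (Submodule.smul_mem _ _ (Submodule.sub_mem _ (m _) (m _))))

/-- The operator `|a⟩⟨b|`. -/
noncomputable def ketBra {ι : Type} [DecidableEq ι] (a b : ι) : TraceClass ι :=
  ⟨InnerProductSpace.rankOne ℂ (ket a) (ket b), rankOne_mem_traceClass _ _⟩

theorem ketBra_apply {ι : Type} [DecidableEq ι] (a b : ι) (v : Fock ι) :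
    (ketBra a b : Fock ι →L[ℂ] Fock ι) v = inner ℂ (ket b) v • ket a := rfl

theorem element_ketBra {ι : Type} [DecidableEq ι] (a b l m : ι) :
    element (ketBra a b) l m = (if l = a then 1 else 0) * (if b = m then 1 else 0) := by
  rw [element, ketBra_apply, inner_smul_right, inner_ket_ket, inner_ket_ket, mul_comm]

theorem ketBra_self_isPositive {ι : Type} [DecidableEq ι] (a : ι) :
    (ketBra a a : Fock ι →L[ℂ] Fock ι).IsPositive :=
  InnerProductSpace.isPositive_rankOne_self _

theorem charFn_ketBra (a b : ℕ) (μ : ℂ) :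
    charFn (ketBra a b) μ = displacementElement μ b a := by
  rw [charFn_eq_tsum, tsum_eq_single a]
  · rw [ketBra_apply, inner_smul_right, inner_ket_ket, if_pos rfl, mul_one]
    rfl
  · intro k hk
    rw [ketBra_apply, inner_smul_right, inner_ket_ket, if_neg hk, mul_zero]

/-! ### Channels -/

theorem isPositive_iff_blockPositive {ι : Type} [DecidableEq ι] (A : TraceClass ι) :
    BlockPositive (fun _ _ : Fin 1 => A) ↔ (A : Fock ι →L[ℂ] Fock ι).IsPositive := by
  rw [ContinuousLinearMap.isPositive_iff_complex]
  simp only [BlockPositive, Finset.univ_unique, Finset.sum_singleton]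
  have e : ∀ x : Fock ι, inner ℂ ((A : Fock ι →L[ℂ] Fock ι) x) x =
      starRingEnd ℂ (inner ℂ x ((A : Fock ι →L[ℂ] Fock ι) x)) := fun x => (inner_conj_symm _ _).symm
  simp only [e, RCLike.re_to_complex, Complex.conj_re]
  constructor
  · intro h x
    obtain ⟨h1, h2⟩ := h fun _ => x
    exact ⟨Complex.ext rfl (by simp only [Complex.conj_im, Complex.ofReal_im, h2, neg_zero]), h1⟩
  · intro h v
    obtain ⟨h1, h2⟩ := h (v default)
    have h3 := congrArg Complex.im h1
    simp only [Complex.ofReal_im, Complex.conj_im] at h3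
    exact ⟨h2, neg_eq_zero.mp h3.symm⟩

theorem IsChannel.isPositive {ι κ : Type} [DecidableEq ι] [DecidableEq κ]
    {Φ : TraceClass ι →ₗ[ℂ] TraceClass κ} (hΦ : IsChannel Φ) {A : TraceClass ι}
    (hA : (A : Fock ι →L[ℂ] Fock ι).IsPositive) : (Φ A : Fock κ →L[ℂ] Fock κ).IsPositive :=
  (isPositive_iff_blockPositive _).mp
    (hΦ.completelyPositive 1 (fun _ _ => A) ((isPositive_iff_blockPositive A).mpr hA))

theorem IsChannel.hasSum_element {ι κ : Type} [DecidableEq ι] [DecidableEq κ]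
    {Φ : TraceClass ι →ₗ[ℂ] TraceClass κ} (hΦ : IsChannel Φ) (A : TraceClass ι) :
    HasSum (fun l => element (Φ A) l l) (∑' a, element A a a) := by
  have h := (summable_element (Φ A)).hasSum
  have e := hΦ.tracePreserving A
  unfold fockTrace at e
  unfold element at *
  rwa [e] at h

/-- The defining relation concerns density operators only; linearity extends it to the operators
`|a⟩⟨b|`, whose diagonals under `P` are needed. -/
theorem IsPhaseInsensitiveGaussian.charFn_eq {τ ν : ℝ} {P : TraceClass ℕ →ₗ[ℂ] TraceClass ℕ}
    (hP : IsPhaseInsensitiveGaussian τ ν P) (A : TraceClass ℕ) (μ : ℂ) :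
    charFn (P A) μ = charFn A ((Real.sqrt τ : ℝ) * μ) *
      ((Real.exp (-(ν * ‖μ‖ ^ 2 / 2)) : ℝ) : ℂ) := by
  induction A using traceClass_induction with
  | pos B h hs =>
    set V : TraceClass ℕ := ketBra 0 0 with hV
    have hVd : IsDensity V := by
      refine ⟨ketBra_self_isPositive 0, ?_⟩
      have : HasSum (fun a : ℕ => element V a a) 1 := by
        have h1 := hasSum_ite_eq (0 : ℕ) (1 : ℂ)
        convert h1 using 2 with a
        rw [hV, element_ketBra]
        by_cases h0 : a = 0 <;> simp [h0, eq_comm]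
      exact this
    obtain ⟨t, ht0, ht⟩ : ∃ t : ℝ, 0 ≤ t ∧ HasSum (fun a => element B a a) (t : ℂ) := by
      have hs := summable_element B
      have h0 : 0 ≤ ∑' a, element B a a := tsum_nonneg fun a => element_nonneg h a
      obtain ⟨h1, h2⟩ := Complex.le_def.mp h0
      refine ⟨(∑' a, element B a a).re, h1, ?_⟩
      have : ((∑' a, element B a a).re : ℂ) = ∑' a, element B a a :=
        Complex.ext rfl (by simpa using h2)
      rw [this]
      exact hs.hasSum
    have hne : (t : ℂ) + 1 ≠ 0 := by exact_mod_cast (by positivity : t + 1 ≠ 0)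
    -- Adding the vacuum projector makes the trace `t + 1` positive even when `B = 0`; its
    -- contribution is subtracted at the end.
    have hRd : IsDensity (((t : ℂ) + 1)⁻¹ • (B + V)) := by
      refine ⟨?_, ?_⟩
      · refine ContinuousLinearMap.IsPositive.smul_of_nonneg (h.add hVd.1) ?_
        have : (0 : ℂ) ≤ ((t + 1)⁻¹ : ℝ) := by
          exact_mod_cast (by positivity : (0 : ℝ) ≤ (t + 1)⁻¹)
        simpa using this
      · have h1 := (ht.add (f := fun a => element B a a) (g := fun a => element V a a)
          hVd.2).mul_left (((t : ℂ) + 1)⁻¹)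
        rw [inv_mul_cancel₀ hne] at h1
        simp only [← element_add] at h1
        simp only [← element_smul] at h1
        exact h1
    have k1 := hP.charFn_apply _ hRd μ
    have k2 := hP.charFn_apply _ hVd μ
    rw [map_smul, map_add, charFn_smul, charFn_smul, charFn_add, charFn_add, mul_assoc] at k1
    have k3 := mul_left_cancel₀ (inv_ne_zero hne) k1
    linear_combination k3 - k2
  | add A B h1 h2 =>
    rw [map_add, charFn_add, charFn_add, h1, h2]
    ring
  | smul c A h1 =>
    rw [map_smul, charFn_smul, charFn_smul, h1]
    ring

/-! ### Angular averages of characteristic functions -/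

theorem hasSum_complex_congr {ι : Type*} {f g : ι → ℂ} {a b : ℂ} (h : HasSum f a)
    (hfg : ∀ k, g k = f k) (hab : b = a) : HasSum g b := by
  rw [hab, funext hfg]
  exact h

theorem integral_exp_int_mul (n : ℤ) :
    ∫ θ in Set.Ioc (0 : ℝ) (2 * Real.pi), Complex.exp ((n : ℂ) * Complex.I * (θ : ℂ)) =
      if n = 0 then ((2 * Real.pi : ℝ) : ℂ) else 0 := by
  rw [← intervalIntegral.integral_of_le (by positivity)]
  by_cases h : n = 0
  · simp [h]
  · rw [if_neg h, integral_exp_mul_complex]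
    · have e : Complex.exp ((n : ℂ) * Complex.I * ((2 * Real.pi : ℝ) : ℂ)) = 1 := by
        rw [Complex.exp_eq_one_iff]
        exact ⟨n, by push_cast; ring⟩
      rw [e]
      simp
    · exact mul_ne_zero (by exact_mod_cast h) Complex.I_ne_zero

theorem displacementElement_circle (r θ : ℝ) (j k : ℕ) :
    displacementElement (r * Complex.exp (θ * Complex.I)) j k =
      Complex.exp ((((j : ℤ) - (k : ℤ) : ℤ) : ℂ) * Complex.I * (θ : ℂ)) *
        displacementElement r j k := by
  have h := displacementElement_rotate (Complex.norm_exp_ofReal_mul_I θ) r j k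
  rw [← Complex.exp_nat_mul, ← Complex.exp_nat_mul] at h
  have h1 := congrArg (fun z => Complex.exp (-(k * (θ * Complex.I))) * z) h
  simp only [← mul_assoc, ← Complex.exp_add] at h1
  rw [neg_add_cancel, Complex.exp_zero, one_mul] at h1
  rw [h1]
  congr 2
  push_cast
  ring

theorem hasSum_inner_displacedKet (v : Fock ℕ) (μ : ℂ) (k : ℕ) :
    HasSum (fun j => starRingEnd ℂ (v j) * displacementElement μ j k)
      (inner ℂ v (displacedKet μ k)) := by
  have h := lp.hasSum_inner (𝕜 := ℂ) v (displacedKet μ k)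
  refine hasSum_complex_congr h (fun j => ?_) rfl
  rw [displacementElement, inner_ket_left, RCLike.inner_apply, mul_comm]

theorem hasSum_inner_displacedKet_circle (v : Fock ℕ) (r θ : ℝ) (k : ℕ) :
    HasSum (fun j : ℕ => Complex.exp ((((j : ℤ) - (k : ℤ) : ℤ) : ℂ) * Complex.I * (θ : ℂ)) *
        (starRingEnd ℂ (v j) * displacementElement r j k))
      (inner ℂ v (displacedKet (r * Complex.exp (θ * Complex.I)) k)) := by
  have h := hasSum_inner_displacedKet v (r * Complex.exp (θ * Complex.I)) k
  simp only [displacementElement_circle] at h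
  exact hasSum_complex_congr h (fun j => by ring) rfl

theorem norm_exp_int_mul (n : ℤ) (θ : ℝ) :
    ‖Complex.exp ((n : ℂ) * Complex.I * (θ : ℂ))‖ = 1 := by
  rw [show (n : ℂ) * Complex.I * (θ : ℂ) = ((n * θ : ℝ) : ℂ) * Complex.I by push_cast; ring,
    Complex.norm_exp_ofReal_mul_I]

theorem continuous_inner_displacedKet_circle (v : Fock ℕ) (r : ℝ) (k : ℕ) :
    Continuous fun θ : ℝ => inner ℂ v (displacedKet (r * Complex.exp (θ * Complex.I)) k) := by
  simp only [← (hasSum_inner_displacedKet_circle v r _ k).tsum_eq]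
  refine continuous_tsum (fun j => by fun_prop)
    (hasSum_inner_displacedKet v r k).summable.norm fun j θ => ?_
  rw [norm_mul, norm_exp_int_mul, one_mul]

/-- The expansion in number states is a Fourier series in `θ` with frequencies `j - k`, so
integration keeps only `j = k`. -/
theorem integral_inner_displacedKet_circle (v : Fock ℕ) (r : ℝ) (k : ℕ) :
    ∫ θ in Set.Ioc (0 : ℝ) (2 * Real.pi),
        inner ℂ v (displacedKet (r * Complex.exp (θ * Complex.I)) k) =
      ((2 * Real.pi : ℝ) : ℂ) * (starRingEnd ℂ (v k) * (displacementDiag k (r ^ 2) : ℝ)) := by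
  simp only [← (hasSum_inner_displacedKet_circle v r _ k).tsum_eq]
  refine (hasSum_integral_of_summable_integral_norm (fun j => ?_) ?_).unique ?_
  · exact (Continuous.integrableOn_Ioc (by fun_prop))
  · simp only [norm_mul, norm_exp_int_mul, one_mul, integral_const]
    have h := (hasSum_inner_displacedKet v r k).summable.norm
    simp only [norm_mul] at h
    exact h.const_smul _
  · simp only [integral_mul_const, integral_exp_int_mul]
    have h := hasSum_ite_eq k (((2 * Real.pi : ℝ) : ℂ) *
      (starRingEnd ℂ (v k) * (displacementDiag k (r ^ 2) : ℝ)))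
    refine hasSum_complex_congr h (fun j => ?_) rfl
    by_cases hj : j = k
    · subst hj; simp [displacementElement_self]
    · have : ¬ ((j : ℤ) - k = 0) := by omega
      simp [hj, this]

theorem inner_apply_eq_inner_adjoint (A : TraceClass ℕ) (k : ℕ) (w : Fock ℕ) :
    inner ℂ (ket k) ((A : Fock ℕ →L[ℂ] Fock ℕ) w) =
      inner ℂ (ContinuousLinearMap.adjoint (A : Fock ℕ →L[ℂ] Fock ℕ) (ket k)) w :=
  (ContinuousLinearMap.adjoint_inner_left _ _ _).symm

theorem conj_adjoint_ket_apply (A : TraceClass ℕ) (k : ℕ) :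
    starRingEnd ℂ (ContinuousLinearMap.adjoint (A : Fock ℕ →L[ℂ] Fock ℕ) (ket k) k) =
      element A k k := by
  rw [← inner_ket_left, inner_conj_symm, ContinuousLinearMap.adjoint_inner_left]
  rfl

theorem continuous_diagonal_circle (A : TraceClass ℕ) (r : ℝ) (k : ℕ) :
    Continuous fun θ : ℝ => inner ℂ (ket k)
      ((A : Fock ℕ →L[ℂ] Fock ℕ) (displacedKet (r * Complex.exp (θ * Complex.I)) k)) := by
  simp only [inner_apply_eq_inner_adjoint]
  exact continuous_inner_displacedKet_circle _ _ _

/-- Justifies exchanging the trace with the angular integral. For positive operators the bound of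
`sum_norm_inner_le` is uniform in `θ`, since the displaced kets are orthonormal for every `μ`. -/
theorem summable_integral_norm_diagonal (A : TraceClass ℕ) (r : ℝ) :
    Summable fun k => ∫ θ in Set.Ioc (0 : ℝ) (2 * Real.pi), ‖inner ℂ (ket k)
      ((A : Fock ℕ →L[ℂ] Fock ℕ) (displacedKet (r * Complex.exp (θ * Complex.I)) k))‖ := by
  have hint : ∀ (A : TraceClass ℕ) (k : ℕ), IntegrableOn (fun θ : ℝ => ‖inner ℂ (ket k)
      ((A : Fock ℕ →L[ℂ] Fock ℕ) (displacedKet (r * Complex.exp (θ * Complex.I)) k))‖)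
      (Set.Ioc (0 : ℝ) (2 * Real.pi)) := fun A k =>
    (continuous_diagonal_circle A r k).norm.integrableOn_Ioc
  induction A using traceClass_induction with
  | pos A h hs =>
    refine summable_of_sum_le (c := (2 * Real.pi) * ∑' a : ℕ, ‖inner ℂ (ket a)
      ((A : Fock ℕ →L[ℂ] Fock ℕ) (ket a))‖) (fun _ => integral_nonneg fun _ => norm_nonneg _)
      fun F => ?_
    rw [← integral_finsetSum _ fun k _ => hint A k]
    refine (integral_mono (integrable_finsetSum _ fun k _ => hint A k)
      (integrable_const _) fun θ => sum_norm_inner_le h hs (displacedKet_orthonormal _) F).trans ?_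
    simp [Real.pi_pos.le]
  | add A B h1 h2 =>
    refine Summable.of_nonneg_of_le (fun _ => integral_nonneg fun _ => norm_nonneg _)
      (fun k => ?_) (h1.add h2)
    rw [← integral_add (hint A k) (hint B k)]
    refine integral_mono (hint _ k) ((hint A k).add (hint B k)) fun θ => ?_
    simp only [Submodule.coe_add, add_apply, inner_add_right]
    exact norm_add_le _ _
  | smul c A h =>
    simp only [Submodule.coe_smul, smul_apply, inner_smul_right, norm_mul, integral_const_mul]
    exact h.mul_left _

theorem hasSum_integral_charFn_circle (A : TraceClass ℕ) (r : ℝ) :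
    HasSum (fun k => ((2 * Real.pi : ℝ) : ℂ) * (element A k k * (displacementDiag k (r ^ 2) : ℝ)))
      (∫ θ in Set.Ioc (0 : ℝ) (2 * Real.pi), charFn A (r * Complex.exp (θ * Complex.I))) := by
  have h := hasSum_integral_of_summable_integral_norm
    (fun k => (continuous_diagonal_circle A r k).integrableOn_Ioc)
    (summable_integral_norm_diagonal A r)
  simp only [← charFn_eq_tsum] at h
  simp only [inner_apply_eq_inner_adjoint, integral_inner_displacedKet_circle,
    conj_adjoint_ket_apply] at h
  exact h

/-- The diagonal of `P |a⟩⟨b|` determined by the characteristic function. -/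
theorem IsPhaseInsensitiveGaussian.hasSum_displacementDiag {τ ν : ℝ} (hτ : 0 ≤ τ)
    {P : TraceClass ℕ →ₗ[ℂ] TraceClass ℕ} (hP : IsPhaseInsensitiveGaussian τ ν P) (a b : ℕ)
    {x : ℝ} (hx : 0 ≤ x) :
    HasSum (fun k => element (P (ketBra a b)) k k * (displacementDiag k x : ℝ))
      (if a = b then ((displacementDiag a (τ * x) * Real.exp (-(ν * x / 2)) : ℝ) : ℂ) else 0) := by
  have h := hasSum_integral_charFn_circle (P (ketBra a b)) (Real.sqrt x)
  -- On the circle of radius `√x` the channel relation depends on `θ` only through the phase of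
  -- frequency `b - a`, whose integral vanishes unless `a = b`.
  have e : ∀ θ : ℝ, charFn (P (ketBra a b)) ((Real.sqrt x : ℝ) * Complex.exp (θ * Complex.I)) =
      Complex.exp ((((b : ℤ) - (a : ℤ) : ℤ) : ℂ) * Complex.I * (θ : ℂ)) *
        (displacementElement (Real.sqrt (τ * x) : ℝ) b a *
          ((Real.exp (-(ν * x / 2)) : ℝ) : ℂ)) := by
    intro θ
    rw [hP.charFn_eq, charFn_ketBra, ← mul_assoc, ← Complex.ofReal_mul, ← Real.sqrt_mul hτ,
      displacementElement_circle, norm_mul, Complex.norm_exp_ofReal_mul_I, mul_one,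
      Complex.norm_real, Real.norm_eq_abs, sq_abs, Real.sq_sqrt hx, mul_assoc]
  simp only [e, integral_mul_const, integral_exp_int_mul, Real.sq_sqrt hx] at h
  have hpi : ((2 * Real.pi : ℝ) : ℂ) ≠ 0 := by
    exact_mod_cast (by positivity : (2 * Real.pi : ℝ) ≠ 0)
  have h2 := h.mul_left (((2 * Real.pi : ℝ) : ℂ)⁻¹)
  simp only [inv_mul_cancel_left₀ hpi] at h2
  refine hasSum_complex_congr h2 (fun _ => rfl) ?_
  by_cases hab : a = b
  · subst hab
    rw [displacementElement_self, Real.sq_sqrt (by positivity)]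
    simp only [sub_self, if_true]
    rw [inv_mul_cancel_left₀ hpi]
    push_cast
    rfl
  · have : ¬ ((b : ℤ) - a = 0) := by omega
    simp [hab, this]

/-! ### Laplace transforms -/

theorem integrableOn_pow_mul_exp_neg {P : ℝ} (hP : 0 < P) (m : ℕ) :
    IntegrableOn (fun x : ℝ => x ^ m * Real.exp (-(P * x))) (Set.Ioi 0) ∧
      ∫ x in Set.Ioi (0 : ℝ), x ^ m * Real.exp (-(P * x)) = P⁻¹ ^ (m + 1) * m.factorial := by
  have h := Real.integral_rpow_mul_exp_neg_mul_Ioi (a := (m : ℝ) + 1) (by positivity) hP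
  rw [add_sub_cancel_right, Real.Gamma_nat_eq_factorial, one_div] at h
  have e : P⁻¹ ^ ((m : ℝ) + 1) = P⁻¹ ^ (m + 1) := by exact_mod_cast Real.rpow_natCast P⁻¹ (m + 1)
  rw [e] at h
  simp only [Real.rpow_natCast] at h
  refine ⟨?_, h⟩
  -- A non-integrable function has integral `0` by convention, which contradicts the positive Gamma
  -- value.
  by_contra hn
  rw [integral_undef hn] at h
  have : 0 < P⁻¹ ^ (m + 1) * m.factorial := by positivity
  linarith

/-- The Gamma integrals cancel the factorials and leave a binomial expansion. The scale `t` is `1`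
for the output diagonal and `τ` for the input. -/
theorem laplace_displacementPoly (t : ℝ) {P : ℝ} (hP : 0 < P) (k : ℕ) :
    IntegrableOn (fun x : ℝ => Real.exp (-(P * x)) * ∑ q ∈ Finset.range (k + 1),
      (k.choose q : ℝ) * (((k - q).factorial : ℝ)⁻¹ * (-(t * x)) ^ (k - q))) (Set.Ioi 0) ∧
    ∫ x in Set.Ioi (0 : ℝ), Real.exp (-(P * x)) * ∑ q ∈ Finset.range (k + 1),
      (k.choose q : ℝ) * (((k - q).factorial : ℝ)⁻¹ * (-(t * x)) ^ (k - q)) =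
      P⁻¹ * (1 - t * P⁻¹) ^ k := by
  have e : ∀ x : ℝ, Real.exp (-(P * x)) * ∑ q ∈ Finset.range (k + 1),
      (k.choose q : ℝ) * (((k - q).factorial : ℝ)⁻¹ * (-(t * x)) ^ (k - q)) =
      ∑ q ∈ Finset.range (k + 1), ((k.choose q : ℝ) * (((k - q).factorial : ℝ)⁻¹ *
        (-t) ^ (k - q))) * (x ^ (k - q) * Real.exp (-(P * x))) := by
    intro x
    rw [Finset.mul_sum]
    refine Finset.sum_congr rfl fun q _ => ?_
    rw [show -(t * x) = -t * x by ring, mul_pow]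
    ring
  simp only [e]
  have hi : ∀ q ∈ Finset.range (k + 1), IntegrableOn (fun x : ℝ =>
      ((k.choose q : ℝ) * (((k - q).factorial : ℝ)⁻¹ * (-t) ^ (k - q))) *
        (x ^ (k - q) * Real.exp (-(P * x)))) (Set.Ioi 0) := fun q _ =>
    (integrableOn_pow_mul_exp_neg hP (k - q)).1.const_mul _
  refine ⟨integrable_finsetSum _ hi, ?_⟩
  rw [integral_finsetSum _ hi]
  simp only [integral_const_mul, (integrableOn_pow_mul_exp_neg hP _).2]
  rw [show 1 - t * P⁻¹ = 1 + (-t) * P⁻¹ by ring, add_pow, Finset.mul_sum]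
  refine Finset.sum_congr rfl fun q _ => ?_
  have hf : ((k - q).factorial : ℝ) ≠ 0 := by exact_mod_cast (k - q).factorial_ne_zero
  rw [one_pow, one_mul, mul_pow, pow_succ]
  field_simp

theorem laplace_displacementDiag {t : ℝ} (s : ℝ) (hs : 0 < s + t / 2) (k : ℕ) :
    IntegrableOn (fun x : ℝ => Real.exp (-(s * x)) * displacementDiag k (t * x)) (Set.Ioi 0) ∧
    ∫ x in Set.Ioi (0 : ℝ), Real.exp (-(s * x)) * displacementDiag k (t * x) =
      (s + t / 2)⁻¹ * (1 - t * (s + t / 2)⁻¹) ^ k := by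
  have h := laplace_displacementPoly t hs k
  have e : ∀ x : ℝ, Real.exp (-(s * x)) * displacementDiag k (t * x) =
      Real.exp (-((s + t / 2) * x)) * ∑ q ∈ Finset.range (k + 1),
      (k.choose q : ℝ) * (((k - q).factorial : ℝ)⁻¹ * (-(t * x)) ^ (k - q)) := by
    intro x
    rw [displacementDiag, ← mul_assoc, ← Real.exp_add]
    congr 2
    ring
  simpa only [e] using h

/-- It is a matrix element between two unit vectors. This bound dominates the series when sum and
Laplace integral are exchanged. -/
theorem abs_displacementDiag_le_one (k : ℕ) {x : ℝ} (hx : 0 ≤ x) : |displacementDiag k x| ≤ 1 := by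
  have h := displacementElement_self (Real.sqrt x) k
  rw [Real.sq_sqrt hx] at h
  rw [← Real.norm_eq_abs, ← Complex.norm_real, ← h]
  refine (norm_inner_le_norm _ _).trans ?_
  rw [ket_norm, (displacedKet_orthonormal _).1 k, one_mul]

theorem hasSum_laplace_displacementDiag {c : ℕ → ℂ} (hc : Summable fun k => ‖c k‖) {s : ℝ}
    (hs : 0 < s) :
    HasSum (fun k => c k * (((s + 1 / 2)⁻¹ * (1 - (s + 1 / 2)⁻¹) ^ k : ℝ) : ℂ))
      (∫ x in Set.Ioi (0 : ℝ), ((Real.exp (-(s * x)) : ℝ) : ℂ) *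
        ∑' k, c k * (displacementDiag k x : ℝ)) := by
  have hl := fun k => laplace_displacementDiag (t := 1) s (by linarith) k
  simp only [one_mul] at hl
  have hF : ∀ k, IntegrableOn (fun x : ℝ => c k *
      ((Real.exp (-(s * x)) * displacementDiag k x : ℝ) : ℂ)) (Set.Ioi 0) := fun k =>
    (hl k).1.ofReal.const_mul _
  have hexp := integrableOn_pow_mul_exp_neg hs 0
  simp only [pow_zero, one_mul] at hexp
  have h := hasSum_integral_of_summable_integral_norm hF ?_
  · refine hasSum_complex_congr h (fun k => ?_) ?_
    · rw [integral_const_mul, integral_complex_ofReal, (hl k).2]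
    · refine integral_congr_ae (Filter.Eventually.of_forall fun x => ?_)
      simp only
      rw [← tsum_mul_left]
      refine tsum_congr fun k => ?_
      push_cast
      ring
  · refine Summable.of_nonneg_of_le (fun _ => integral_nonneg fun _ => norm_nonneg _)
      (fun k => ?_) (hc.mul_right (∫ x in Set.Ioi (0 : ℝ), Real.exp (-(s * x))))
    rw [← integral_const_mul]
    refine setIntegral_mono_on (hF k).norm (hexp.1.const_mul _) measurableSet_Ioi fun x hx => ?_
    rw [norm_mul, Complex.norm_real, norm_mul, Real.norm_of_nonneg (Real.exp_nonneg _),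
      Real.norm_eq_abs]
    have := abs_displacementDiag_le_one k (le_of_lt (Set.mem_Ioi.mp hx))
    gcongr
    exact mul_le_of_le_one_right (Real.exp_nonneg _) this

/-! ### Photon-number statistics of the channel output -/

/-- `(1 + κ y)⁻¹ (1 - τ y / (1 + κ y))ᵃ`, the mean of `(1 - y)ᴺ` for the output photon number `N`
of the channel applied to `|a⟩⟨a|`. -/
noncomputable def outputGenerating (τ κ y : ℝ) (a : ℕ) : ℝ :=
  (1 + κ * y)⁻¹ * (1 - τ * (y * (1 + κ * y)⁻¹)) ^ a

theorem IsPhaseInsensitiveGaussian.hasSum_generating {τ ν : ℝ} (hτ : 0 ≤ τ)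
    (hκ : 0 ≤ (τ + ν - 1) / 2) {P : TraceClass ℕ →ₗ[ℂ] TraceClass ℕ}
    (hP : IsPhaseInsensitiveGaussian τ ν P) (a b : ℕ) {y : ℝ} (hy0 : 0 < y) (hy1 : y ≤ 1) :
    HasSum (fun k => element (P (ketBra a b)) k k * (((1 - y) ^ k : ℝ) : ℂ))
      (if a = b then (outputGenerating τ ((τ + ν - 1) / 2) y a : ℂ) else 0) := by
  -- The Laplace variable `s = y⁻¹ - 1/2` is chosen so that the transform of `displacementDiag k` is
  -- exactly `y (1 - y) ^ k`.
  have hs : 0 < y⁻¹ - 1 / 2 := by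
    have := (one_le_inv₀ hy0).mpr hy1
    linarith
  have h := hasSum_laplace_displacementDiag (summable_element (P (ketBra a b))).norm hs
  rw [sub_add_cancel, inv_inv] at h
  have hyc : (y : ℂ) ≠ 0 := by exact_mod_cast hy0.ne'
  have h2 := h.mul_left ((y : ℂ)⁻¹)
  refine hasSum_complex_congr h2 (fun k => ?_) ?_
  · push_cast
    field_simp
  · have e : ∫ x in Set.Ioi (0 : ℝ), ((Real.exp (-((y⁻¹ - 1 / 2) * x)) : ℝ) : ℂ) *
        ∑' k, element (P (ketBra a b)) k k * (displacementDiag k x : ℝ) =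
      ∫ x in Set.Ioi (0 : ℝ), ((Real.exp (-((y⁻¹ - 1 / 2) * x)) : ℝ) : ℂ) *
        (if a = b then ((displacementDiag a (τ * x) * Real.exp (-(ν * x / 2)) : ℝ) : ℂ)
          else 0) := by
      refine setIntegral_congr_fun measurableSet_Ioi fun x hx => ?_
      rw [(hP.hasSum_displacementDiag hτ a b (le_of_lt (Set.mem_Ioi.mp hx))).tsum_eq]
    rw [e]
    by_cases hab : a = b
    · simp only [hab, if_true, ← Complex.ofReal_mul, integral_complex_ofReal]
      -- The Gaussian factor shifts `s` by `ν/2` and the Laguerre weight by `τ/2`; this is where the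
      -- added photon number `(τ + ν - 1)/2` appears.
      have hq : (y⁻¹ - 1 / 2 + ν / 2) + τ / 2 = (1 + (τ + ν - 1) / 2 * y) / y := by
        field_simp
        ring
      have hpos : 0 < 1 + (τ + ν - 1) / 2 * y := by positivity
      have hl := (laplace_displacementDiag (t := τ) (y⁻¹ - 1 / 2 + ν / 2)
        (by rw [hq]; positivity) b).2
      have e2 : ∀ x : ℝ, Real.exp (-((y⁻¹ - 1 / 2) * x)) *
          (displacementDiag b (τ * x) * Real.exp (-(ν * x / 2))) =
          Real.exp (-((y⁻¹ - 1 / 2 + ν / 2) * x)) * displacementDiag b (τ * x) := by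
        intro x
        rw [mul_comm (displacementDiag _ _), ← mul_assoc, ← Real.exp_add]
        congr 2
        ring
      simp only [e2]
      rw [hl, hq, inv_div, outputGenerating, ← Complex.ofReal_inv, ← Complex.ofReal_mul]
      congr 1
      rw [div_eq_mul_inv]
      field_simp
    · simp [hab]

/-- Identity theorem for power series: once the lower coefficients vanish, dividing by `z ^ n`
bounds `c n` by `z` times a constant, and `z → 0`. -/
theorem eq_zero_of_hasSum_pow {c : ℕ → ℂ} (hc : Summable fun k => ‖c k‖)
    (h : ∀ y : ℝ, 0 < y → y ≤ 1 → HasSum (fun k => c k * (((1 - y) ^ k : ℝ) : ℂ)) 0) (n : ℕ) :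
    c n = 0 := by
  induction n using Nat.strong_induction_on with
  | _ n ih =>
    have key : ∀ z : ℝ, 0 < z → z < 1 → ‖c n‖ ≤ z * ∑' k, ‖c k‖ := by
      intro z hz0 hz1
      have h1 := h (1 - z) (by linarith) (by linarith)
      rw [sub_sub_cancel] at h1
      have h2 := (hasSum_nat_add_iff' n).mpr h1
      rw [Finset.sum_eq_zero (fun i hi => by rw [ih i (Finset.mem_range.mp hi), zero_mul]),
        sub_zero] at h2
      have h3 := h2.mul_left ((((z ^ n)⁻¹ : ℝ)) : ℂ)
      have h4 := (hasSum_nat_add_iff' 1).mpr h3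
      rw [Finset.sum_range_one, mul_zero, zero_sub, zero_add, mul_left_comm, ← Complex.ofReal_mul,
        inv_mul_cancel₀ (by positivity), Complex.ofReal_one, mul_one] at h4
      have hb : ∀ k : ℕ, ‖(((z ^ n)⁻¹ : ℝ) : ℂ) *
          (c (k + 1 + n) * ((z ^ (k + 1 + n) : ℝ) : ℂ))‖ ≤ z * ‖c (k + (1 + n))‖ := by
        intro k
        have e : (((z ^ n)⁻¹ : ℝ) : ℂ) * (c (k + 1 + n) * ((z ^ (k + 1 + n) : ℝ) : ℂ)) =
            ((z * z ^ k : ℝ) : ℂ) * c (k + (1 + n)) := by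
          rw [mul_left_comm, ← Complex.ofReal_mul, add_assoc k 1 n, mul_comm (c _)]
          congr 2
          rw [pow_add, pow_add]
          field_simp
        rw [e, norm_mul, Complex.norm_real, Real.norm_of_nonneg (by positivity)]
        gcongr
        exact mul_le_of_le_one_right hz0.le (pow_le_one₀ hz0.le hz1.le)
      have hs' := ((summable_nat_add_iff (1 + n)).mpr hc).mul_left z
      have h5 := h4.norm_le_of_bounded hs'.hasSum hb
      rw [norm_neg, tsum_mul_left] at h5
      refine h5.trans (mul_le_mul_of_nonneg_left ?_ hz0.le)
      rw [← hc.sum_add_tsum_nat_add (1 + n)]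
      exact le_add_of_nonneg_left (Finset.sum_nonneg fun _ _ => norm_nonneg _)
    have hlim : Filter.Tendsto (fun z : ℝ => z * ∑' k, ‖c k‖) (nhdsWithin 0 (Set.Ioi 0))
        (nhds 0) := by
      have : Filter.Tendsto (fun z : ℝ => z * ∑' k, ‖c k‖) (nhds 0) (nhds (0 * ∑' k, ‖c k‖)) :=
        (continuous_id.mul continuous_const).tendsto 0
      rw [zero_mul] at this
      exact this.mono_left nhdsWithin_le_nhds
    have hle : ‖c n‖ ≤ 0 := by
      refine ge_of_tendsto hlim ?_
      filter_upwards [Ioo_mem_nhdsGT (zero_lt_one' ℝ)] with z hz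
      exact key z hz.1 hz.2
    exact norm_le_zero_iff.mp hle

/-- For `a ≠ b` the generating function of the output diagonal vanishes identically. -/
theorem IsPhaseInsensitiveGaussian.element_offDiagonal {τ ν : ℝ} (hτ : 0 ≤ τ)
    (hκ : 0 ≤ (τ + ν - 1) / 2) {P : TraceClass ℕ →ₗ[ℂ] TraceClass ℕ}
    (hP : IsPhaseInsensitiveGaussian τ ν P) {a b : ℕ} (hab : a ≠ b) (l : ℕ) :
    element (P (ketBra a b)) l l = 0 := by
  refine eq_zero_of_hasSum_pow (summable_element (P (ketBra a b))).norm (fun y hy0 hy1 => ?_) l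
  simpa [hab] using hP.hasSum_generating hτ hκ a b hy0 hy1

/-! ### Concentration of the total photon number -/

theorem mem_cutoffStrings {n L : ℕ} {l : Fin n → ℕ} : l ∈ cutoffStrings n L ↔ ∑ i, l i ≤ L := by
  simp only [cutoffStrings, Finset.mem_filter, Fintype.mem_piFinset, Finset.mem_range,
    and_iff_right_iff_imp]
  intro h i
  exact Nat.lt_succ_of_le ((Finset.single_le_sum (fun _ _ => Nat.zero_le _)
    (Finset.mem_univ i)).trans h)

/-- Chebyshev's inequality for `z ^ X`, where `X` is a sum of independent variables valued in
`ℕ`. -/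
theorem cutoff_sum_ge {n : ℕ} {p : Fin n → ℕ → ℝ} (hp0 : ∀ i l, 0 ≤ p i l)
    (hp1 : ∀ i, HasSum (p i) 1) {z : ℝ} (hz0 : 0 ≤ z) (hz1 : z ≤ 1) {g h : Fin n → ℝ}
    (hg : ∀ i, HasSum (fun l => p i l * z ^ l) (g i))
    (hh : ∀ i, HasSum (fun l => p i l * (z ^ 2) ^ l) (h i)) (hgpos : 0 < ∏ i, g i)
    {c : ℝ} (hc1 : c < 1) {L : ℕ} (hL : z ^ L ≤ c * ∏ i, g i) :
    1 - ((∏ i, h i) / (∏ i, g i) ^ 2 - 1) / (1 - c) ^ 2 ≤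
      ∑ l ∈ cutoffStrings n L, ∏ i, p i (l i) := by
  set w := ∏ i, g i with hw
  -- Expectations over all strings are taken as limits over boxes `[0, M)ⁿ`, where a product of sums
  -- is a finite sum of products.
  have hlim : ∀ {f : Fin n → ℕ → ℝ} {s : Fin n → ℝ}, (∀ i, HasSum (f i) (s i)) →
      Filter.Tendsto (fun M => ∏ i, ∑ l ∈ Finset.range M, f i l) Filter.atTop
        (nhds (∏ i, s i)) := fun hf => tendsto_finsetProd _ fun i _ => (hf i).tendsto_sum_nat
  have hA := hlim hp1
  have hB := hlim hg
  have hC := hlim hh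
  rw [Finset.prod_const_one] at hA
  have hT := hA.sub ((((hA.const_mul (w ^ 2)).sub (hB.const_mul (2 * w))).add hC).div_const
    ((1 - c) ^ 2 * w ^ 2))
  have hc : 0 < 1 - c := by linarith
  have e : 1 - (w ^ 2 * 1 - 2 * w * ∏ i, g i + ∏ i, h i) / ((1 - c) ^ 2 * w ^ 2) =
      1 - ((∏ i, h i) / w ^ 2 - 1) / (1 - c) ^ 2 := by
    rw [← hw]
    field_simp
    ring
  rw [e] at hT
  refine le_of_tendsto hT ?_
  filter_upwards [Filter.eventually_ge_atTop (L + 1)] with M hM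
  set S := Fintype.piFinset fun _ : Fin n => Finset.range M with hS
  have hsub : cutoffStrings n L ⊆ S := by
    intro l hl
    rw [mem_cutoffStrings] at hl
    rw [hS, Fintype.mem_piFinset]
    intro i
    rw [Finset.mem_range]
    have := Finset.single_le_sum (f := l) (fun _ _ => Nat.zero_le _) (Finset.mem_univ i)
    omega
  simp only [Finset.prod_univ_sum, ← hS]
  rw [← Finset.sum_sdiff hsub, sub_le_iff_le_add, add_comm (∑ l ∈ cutoffStrings n L, _) (_ / _)]
  refine (add_le_add_iff_right _).mpr ?_
  rw [le_div_iff₀ (by positivity)]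
  have hpp : ∀ l : Fin n → ℕ, 0 ≤ ∏ i, p i (l i) := fun l =>
    Finset.prod_nonneg fun i _ => hp0 i _
  -- The truncated second moment of `z ^ X` about `w`; in the limit it is the variance.
  have e2 : w ^ 2 * (∑ l ∈ S \ cutoffStrings n L, ∏ i, p i (l i) +
        ∑ l ∈ cutoffStrings n L, ∏ i, p i (l i)) -
      2 * w * ∑ l ∈ S, ∏ i, p i (l i) * z ^ l i + ∑ l ∈ S, ∏ i, p i (l i) * (z ^ 2) ^ l i =
      ∑ l ∈ S, (∏ i, p i (l i)) * (w - z ^ (∑ i, l i)) ^ 2 := by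
    rw [Finset.sum_sdiff hsub, Finset.mul_sum, Finset.mul_sum, ← Finset.sum_sub_distrib,
      ← Finset.sum_add_distrib]
    refine Finset.sum_congr rfl fun l _ => ?_
    rw [Finset.prod_mul_distrib, Finset.prod_mul_distrib, Finset.prod_pow_eq_pow_sum,
      Finset.prod_pow_eq_pow_sum]
    ring
  rw [e2, Finset.sum_mul]
  refine (Finset.sum_le_sum fun l hl => ?_).trans (Finset.sum_le_sum_of_subset_of_nonneg
    Finset.sdiff_subset fun l _ _ => mul_nonneg (hpp l) (sq_nonneg _))
  rw [Finset.mem_sdiff, mem_cutoffStrings, not_le] at hl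
  refine mul_le_mul_of_nonneg_left ?_ (hpp l)
  -- A string above the cutoff has `z ^ X ≤ z ^ L ≤ c w`, so its deviation from `w` is at least `(1
  -- - c) w`.
  rw [← mul_pow]
  have h1 : z ^ (∑ i, l i) ≤ z ^ L := pow_le_pow_of_le_one hz0 hz1 hl.2.le
  refine pow_le_pow_left₀ (by positivity) ?_ 2
  linarith

/-- Follows from `(1 - t)(1 + t + 2t²) = 1 + t²(1 - 2t) ≥ 1`. -/
theorem exp_neg_le_one_sub {t : ℝ} (ht : t ≤ 1 / 2) :
    Real.exp (-(t + 2 * t ^ 2)) ≤ 1 - t := by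
  have h1 : 1 + (t + 2 * t ^ 2) ≤ Real.exp (t + 2 * t ^ 2) := by
    linarith [Real.add_one_le_exp (t + 2 * t ^ 2)]
  rw [Real.exp_neg, inv_le_comm₀ (Real.exp_pos _) (by linarith)]
  refine le_trans ?_ h1
  rw [inv_le_iff_one_le_mul₀ (by linarith)]
  nlinarith [mul_nonneg (sq_nonneg t) (by linarith : 0 ≤ 1 - 2 * t)]

theorem mul_inv_one_add_bounds {κ y : ℝ} (hκ : 0 ≤ κ) (hy : 0 ≤ y) :
    0 ≤ y * (1 + κ * y)⁻¹ ∧ y * (1 + κ * y)⁻¹ ≤ y := by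
  have h : 0 ≤ κ * y := by positivity
  exact ⟨by positivity, mul_le_of_le_one_right hy (inv_le_one_of_one_le₀ (by linarith))⟩

theorem exp_le_outputGenerating {τ κ y : ℝ} (hτ : 0 ≤ τ) (hκ : 0 ≤ κ) (hy : 0 ≤ y)
    (hτy : τ * y ≤ 1 / 2) (a : ℕ) :
    Real.exp (-(κ * y + a * (τ * y + 2 * (τ * y) ^ 2))) ≤ outputGenerating τ κ y a := by
  have hu := mul_inv_one_add_bounds hκ hy
  have h1 : Real.exp (-(κ * y)) ≤ (1 + κ * y)⁻¹ := by
    rw [Real.exp_neg]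
    refine inv_anti₀ (by positivity) ?_
    linarith [Real.add_one_le_exp (κ * y)]
  have h2 : Real.exp (-(τ * y + 2 * (τ * y) ^ 2)) ≤ 1 - τ * (y * (1 + κ * y)⁻¹) := by
    refine (exp_neg_le_one_sub hτy).trans ?_
    have := mul_le_mul_of_nonneg_left hu.2 hτ
    linarith
  rw [neg_add, Real.exp_add, outputGenerating, ← mul_neg (a : ℝ), Real.exp_nat_mul]
  gcongr

/-- Since `1 - (2y - y²) = (1 - y)²`, this compares the second moment of `(1 - y) ^ N` with its
squared mean. First-order terms in `y` cancel, leaving an exponent of order `y²`. -/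
theorem outputGenerating_sq_le {τ κ y : ℝ} (hτ : 0 ≤ τ) (hκ : 0 ≤ κ) (hy : 0 ≤ y) (hy1 : y ≤ 1)
    (hτy : τ * y ≤ 1 / 2) (a : ℕ) :
    outputGenerating τ κ (2 * y - y ^ 2) a ≤ outputGenerating τ κ y a ^ 2 *
      Real.exp ((κ + κ ^ 2) * y ^ 2 + a * (4 * τ * (1 + 2 * κ) * y ^ 2)) := by
  set y₂ := 2 * y - y ^ 2 with hy₂
  have hy₂0 : 0 ≤ y₂ := by nlinarith
  have hy₂2 : y₂ ≤ 2 * y := by nlinarith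
  have hu := mul_inv_one_add_bounds hκ hy
  have hu₂ := mul_inv_one_add_bounds hκ hy₂0
  have hp : 0 < 1 + κ * y := by positivity
  have hp₂ : 0 < 1 + κ * y₂ := by positivity
  have h1 : (1 + κ * y₂)⁻¹ ≤ ((1 + κ * y)⁻¹) ^ 2 * Real.exp ((κ + κ ^ 2) * y ^ 2) := by
    have hx : 1 + (κ + κ ^ 2) * y ^ 2 ≤ Real.exp ((κ + κ ^ 2) * y ^ 2) := by
      linarith [Real.add_one_le_exp ((κ + κ ^ 2) * y ^ 2)]
    refine le_trans ?_ (mul_le_mul_of_nonneg_left hx (by positivity))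
    rw [inv_pow, inv_mul_eq_div, le_div_iff₀ (by positivity), inv_mul_le_iff₀ hp₂]
    have : 0 ≤ κ * y₂ * ((κ + κ ^ 2) * y ^ 2) := by positivity
    calc (1 + κ * y) ^ 2 = 1 + κ * y₂ + (κ + κ ^ 2) * y ^ 2 := by rw [hy₂]; ring
      _ ≤ (1 + κ * y₂) * (1 + (κ + κ ^ 2) * y ^ 2) := by linarith
  set u := y * (1 + κ * y)⁻¹ with hudef
  set u₂ := y₂ * (1 + κ * y₂)⁻¹ with hu₂def
  have hdiff : 2 * u - u₂ ≤ (1 + 2 * κ) * y ^ 2 := by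
    have e : 2 * u - u₂ = (y ^ 2 + κ * y * y₂) / ((1 + κ * y) * (1 + κ * y₂)) := by
      rw [hudef, hu₂def]
      field_simp
      rw [hy₂]
      ring
    rw [e]
    have h3 : 1 ≤ (1 + κ * y) * (1 + κ * y₂) := by
      nlinarith [mul_nonneg hκ hy, mul_nonneg hκ hy₂0,
        mul_nonneg (mul_nonneg hκ hy) (mul_nonneg hκ hy₂0)]
    refine (div_le_self (by positivity) h3).trans ?_
    nlinarith [mul_le_mul_of_nonneg_left hy₂2 (mul_nonneg hκ hy)]
  have hτu : τ * u ≤ 1 / 2 := (mul_le_mul_of_nonneg_left hu.2 hτ).trans hτy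
  have hτu0 : 0 ≤ τ * u := mul_nonneg hτ hu.1
  have h2 : 1 - τ * u₂ ≤ (1 - τ * u) ^ 2 * Real.exp (4 * τ * (1 + 2 * κ) * y ^ 2) := by
    have hx : 1 + 4 * τ * (1 + 2 * κ) * y ^ 2 ≤ Real.exp (4 * τ * (1 + 2 * κ) * y ^ 2) := by
      linarith [Real.add_one_le_exp (4 * τ * (1 + 2 * κ) * y ^ 2)]
    refine le_trans ?_ (mul_le_mul_of_nonneg_left hx (by positivity))
    -- This lower bound, from `τu ≤ 1/2`, is the origin of the factor `4` in the exponent.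
    have hq : (1 / 4 : ℝ) ≤ (1 - τ * u) ^ 2 := by nlinarith
    have hd : 0 ≤ 4 * τ * (1 + 2 * κ) * y ^ 2 := by positivity
    have h4 := mul_le_mul_of_nonneg_right hq hd
    have h5 := mul_le_mul_of_nonneg_left hdiff hτ
    nlinarith [sq_nonneg (τ * u)]
  have h20 : 0 ≤ 1 - τ * u₂ := by
    have := mul_le_mul_of_nonneg_left (hu₂.2.trans hy₂2) hτ
    linarith
  rw [Real.exp_add, Real.exp_nat_mul, outputGenerating, outputGenerating, ← hudef, ← hu₂def]
  calc (1 + κ * y₂)⁻¹ * (1 - τ * u₂) ^ a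
      ≤ (((1 + κ * y)⁻¹) ^ 2 * Real.exp ((κ + κ ^ 2) * y ^ 2)) *
        ((1 - τ * u) ^ 2 * Real.exp (4 * τ * (1 + 2 * κ) * y ^ 2)) ^ a := by
        gcongr
    _ = _ := by
        rw [mul_pow _ _ a, mul_pow _ _ 2, ← pow_mul, ← pow_mul, mul_comm a 2]
        ring

/-- Concentration of the output photon number, for photon numbers `a` of the input. -/
theorem cutoff_sum_ge_of_outputGenerating {τ κ N δ : ℝ} (hτ : 0 ≤ τ) (hκ : 0 ≤ κ) (hN : 0 ≤ N)
    (hδ : 0 < δ) {n : ℕ} (hn : 2 ≤ n) (hn1 : 2 * τ ≤ n)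
    (hn2 : 2 * (τ + 2 * τ ^ 2 * (N + 1)) / δ ≤ n) {a : Fin n → ℕ}
    (ha : ∑ i, a i ≤ ⌈n * N⌉₊) {p : Fin n → ℕ → ℝ} (hp0 : ∀ i l, 0 ≤ p i l)
    (hp1 : ∀ i, HasSum (p i) 1)
    (hg : ∀ y : ℝ, 0 < y → y ≤ 1 → ∀ i,
      HasSum (fun l => p i l * (1 - y) ^ l) (outputGenerating τ κ y (a i))) :
    1 - (Real.exp ((κ + κ ^ 2 + 4 * τ * (1 + 2 * κ) * (N + 1)) / n) - 1) /
        (1 - Real.exp (-(δ / 2))) ^ 2 ≤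
      ∑ l ∈ cutoffStrings n ⌈n * ((τ * N + κ) + δ)⌉₊, ∏ i, p i (l i) := by
  have hn2' : (2 : ℝ) ≤ n := by exact_mod_cast hn
  have hnpos : (0 : ℝ) < n := by linarith
  -- At the scale `y = 1/n`, first-order exponents summed over `n` modes stay of order one, while
  -- second-order ones are `O(1/n)`.
  set y : ℝ := (n : ℝ)⁻¹ with hy
  have hy0 : 0 < y := by positivity
  have hny : (n : ℝ) * y = 1 := mul_inv_cancel₀ hnpos.ne'
  have hy1 : y ≤ 1 := inv_le_one_of_one_le₀ (by linarith)
  have hτy : τ * y ≤ 1 / 2 := by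
    rw [hy, ← div_eq_mul_inv, div_le_iff₀ hnpos]; linarith
  set K : ℝ := ∑ i, (a i : ℝ) with hK
  have hK0 : 0 ≤ K := Finset.sum_nonneg fun _ _ => Nat.cast_nonneg _
  have hsum : ∀ A B : ℝ, ∑ i, (A + a i * B) = n * A + K * B := by
    intro A B
    simp [Finset.sum_add_distrib, Finset.sum_mul, hK]
  have hKn : K ≤ n * N + 1 := by
    have h1 : K ≤ (⌈n * N⌉₊ : ℝ) := by rw [hK]; exact_mod_cast ha
    exact h1.trans (Nat.ceil_lt_add_one (by positivity)).le
  have hKy : K * y ≤ N + y := by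
    calc K * y ≤ (n * N + 1) * y := by gcongr
      _ = (n * y) * N + y := by ring
      _ = N + y := by rw [hny, one_mul]
  have hKy1 : K * y ≤ N + 1 := by linarith
  have hlow : ∀ i, Real.exp (-(κ * y + a i * (τ * y + 2 * (τ * y) ^ 2))) ≤
      outputGenerating τ κ y (a i) := fun i => exp_le_outputGenerating hτ hκ hy0.le hτy (a i)
  have hgpos : 0 < ∏ i, outputGenerating τ κ y (a i) :=
    Finset.prod_pos fun i _ => (Real.exp_pos _).trans_le (hlow i)
  -- Half of `δ` absorbs the second-order and rounding corrections; the other half leaves the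
  -- Chebyshev gap `c = exp(-δ/2)`.
  have hglow : Real.exp (-(τ * N + κ + δ / 2)) ≤ ∏ i, outputGenerating τ κ y (a i) := by
    refine le_trans ?_ (Finset.prod_le_prod (fun i _ => (Real.exp_pos _).le) fun i _ => hlow i)
    rw [← Real.exp_sum, Real.exp_le_exp, Finset.sum_neg_distrib, hsum, neg_le_neg_iff]
    have h1 : (τ + 2 * τ ^ 2 * (N + 1)) * y ≤ δ / 2 := by
      rw [div_le_iff₀ hδ] at hn2
      have := mul_le_mul_of_nonneg_right hn2 hy0.le
      have e : (n : ℝ) * δ * y = δ := by rw [mul_right_comm, hny, one_mul]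
      linarith
    calc n * (κ * y) + K * (τ * y + 2 * (τ * y) ^ 2)
        = κ * (n * y) + τ * (K * y) + 2 * τ ^ 2 * y * (K * y) := by ring
      _ ≤ κ * 1 + τ * (N + y) + 2 * τ ^ 2 * y * (N + 1) := by rw [hny]; gcongr
      _ = τ * N + κ + (τ + 2 * τ ^ 2 * (N + 1)) * y := by ring
      _ ≤ τ * N + κ + δ / 2 := by linarith
  have hupp : (∏ i, outputGenerating τ κ (2 * y - y ^ 2) (a i)) /
      (∏ i, outputGenerating τ κ y (a i)) ^ 2 ≤
      Real.exp ((κ + κ ^ 2 + 4 * τ * (1 + 2 * κ) * (N + 1)) / n) := by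
    -- Nonnegativity is read off from the series, whose terms are nonnegative.
    have hu0 : ∀ i, 0 ≤ outputGenerating τ κ (2 * y - y ^ 2) (a i) := fun i =>
      (hg (2 * y - y ^ 2) (by nlinarith) (by nlinarith [sq_nonneg (1 - y)]) i).nonneg fun l =>
        mul_nonneg (hp0 i l) (pow_nonneg (by nlinarith [sq_nonneg (1 - y)]) l)
    rw [div_le_iff₀ (by positivity)]
    refine (Finset.prod_le_prod (fun i _ => hu0 i)
      fun i _ => outputGenerating_sq_le hτ hκ hy0.le hy1 hτy (a i)).trans ?_
    rw [Finset.prod_mul_distrib, Finset.prod_pow, ← Real.exp_sum, mul_comm]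
    refine mul_le_mul_of_nonneg_right ?_ (by positivity)
    rw [Real.exp_le_exp, hsum, div_eq_mul_inv, ← hy]
    calc n * ((κ + κ ^ 2) * y ^ 2) + K * (4 * τ * (1 + 2 * κ) * y ^ 2)
        = (κ + κ ^ 2) * y * (n * y) + 4 * τ * (1 + 2 * κ) * y * (K * y) := by ring
      _ ≤ (κ + κ ^ 2) * y * 1 + 4 * τ * (1 + 2 * κ) * y * (N + 1) := by rw [hny]; gcongr
      _ = _ := by ring
  have hc : Real.exp (-(δ / 2)) < 1 := Real.exp_lt_one_iff.mpr (by linarith)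
  set L := ⌈n * ((τ * N + κ) + δ)⌉₊ with hLdef
  have hL : (1 - y) ^ L ≤ Real.exp (-(δ / 2)) * ∏ i, outputGenerating τ κ y (a i) := by
    calc (1 - y) ^ L ≤ (Real.exp (-y)) ^ L :=
          pow_le_pow_left₀ (by linarith) (Real.one_sub_le_exp_neg y) L
      _ = Real.exp (-(L * y)) := by rw [← Real.exp_nat_mul]; congr 1; ring
      _ ≤ Real.exp (-(δ / 2) + -(τ * N + κ + δ / 2)) := by
          rw [Real.exp_le_exp]
          have h1 : n * ((τ * N + κ) + δ) ≤ (L : ℝ) := Nat.le_ceil _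
          have h2 := mul_le_mul_of_nonneg_right h1 hy0.le
          have e : n * ((τ * N + κ) + δ) * y = τ * N + κ + δ := by
            rw [mul_right_comm, hny, one_mul]
          linarith
      _ = Real.exp (-(δ / 2)) * Real.exp (-(τ * N + κ + δ / 2)) := Real.exp_add _ _
      _ ≤ _ := by gcongr
  refine le_trans ?_ (cutoff_sum_ge hp0 hp1 (z := 1 - y) (by linarith) (by linarith)
    (hg y hy0 hy1) (h := fun i => outputGenerating τ κ (2 * y - y ^ 2) (a i)) (fun i => ?_)
    hgpos hc hL)
  · gcongr
  · have h := hg (2 * y - y ^ 2) (by nlinarith) (by nlinarith [sq_nonneg (1 - y)]) i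
    rw [show (1 - y) ^ 2 = 1 - (2 * y - y ^ 2) by ring]
    exact h

/-! ### Compression to a finite set of number states -/

/-- `α + β Π`, where `Π` projects onto the span of the number states in `s`. -/
noncomputable def diagonalScaling {ι : Type} [DecidableEq ι] (s : Finset ι) (α β : ℝ) :
    Fock ι →L[ℂ] Fock ι :=
  (α : ℂ) • ContinuousLinearMap.id ℂ (Fock ι) +
    (β : ℂ) • ∑ a ∈ s, InnerProductSpace.rankOne ℂ (ket a) (ket a)

theorem diagonalScaling_apply {ι : Type} [DecidableEq ι] (s : Finset ι) (α β : ℝ) (v : Fock ι) :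
    diagonalScaling s α β v = (α : ℂ) • v + (β : ℂ) • ∑ a ∈ s, v a • ket a := by
  simp only [diagonalScaling, add_apply, smul_apply, sum_apply, InnerProductSpace.rankOne_apply,
    inner_ket_left, ContinuousLinearMap.id_apply]

theorem sum_smul_ket_apply {ι : Type} [DecidableEq ι] (s : Finset ι) (v : Fock ι) :
    ∑ a ∈ s, v a • (ket a : Fock ι) =
      (∑ a ∈ s, InnerProductSpace.rankOne ℂ (ket a) (ket a)) v := by
  simp [sum_apply, InnerProductSpace.rankOne_apply, inner_ket_left]

theorem inner_ket_sum_smul_ket {ι : Type} [DecidableEq ι] (s : Finset ι) (c : ι → ℂ) (b : ι) :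
    inner ℂ (ket b) (∑ a ∈ s, c a • (ket a : Fock ι)) = if b ∈ s then c b else 0 := by
  simp [inner_ket_ket]

theorem diagonalScaling_symmetric {ι : Type} [DecidableEq ι] (s : Finset ι) (α β : ℝ)
    (u v : Fock ι) :
    inner ℂ (diagonalScaling s α β u) v = inner ℂ u (diagonalScaling s α β v) := by
  simp only [diagonalScaling_apply, inner_add_left, inner_add_right, inner_smul_left,
    inner_smul_right, Complex.conj_ofReal, sum_inner, inner_sum, inner_ket_left]
  congr 2
  refine Finset.sum_congr rfl fun a _ => ?_
  rw [← inner_conj_symm u, inner_ket_left, mul_comm]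

theorem diagonalScaling_ket {ι : Type} [DecidableEq ι] (s : Finset ι) (α β : ℝ) (a : ι) :
    diagonalScaling s α β (ket a) = ((α + if a ∈ s then β else 0 : ℝ) : ℂ) • ket a := by
  have h : ∑ b ∈ s, (ket a : Fock ι) b • (ket b : Fock ι) = if a ∈ s then ket a else 0 := by
    simp only [← inner_ket_left, inner_ket_ket, ite_smul, one_smul, zero_smul]
    rw [Finset.sum_ite_eq']
  rw [diagonalScaling_apply, h]
  split_ifs <;> simp [add_smul]

theorem exists_compression {ι : Type} [DecidableEq ι] {ρ : TraceClass ι}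
    (hρ : (ρ : Fock ι →L[ℂ] Fock ι).IsPositive) (s : Finset ι) (α β : ℝ) :
    ∃ X : TraceClass ι, (X : Fock ι →L[ℂ] Fock ι).IsPositive ∧
      (∀ v, (X : Fock ι →L[ℂ] Fock ι) v =
        diagonalScaling s α β ((ρ : Fock ι →L[ℂ] Fock ι) (diagonalScaling s α β v))) ∧
      ∀ a, element X a a = (((α + if a ∈ s then β else 0) ^ 2 : ℝ) : ℂ) * element ρ a a := by
  set C := diagonalScaling s α β with hC
  have hadj : ContinuousLinearMap.adjoint C = C := by
    refine ((ContinuousLinearMap.eq_adjoint_iff C C).mpr fun u v => ?_).symm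
    exact diagonalScaling_symmetric s α β u v
  have hpos := hρ.adjoint_conj C
  rw [hadj] at hpos
  have he : ∀ a, inner ℂ (ket a) ((C ∘L (ρ : Fock ι →L[ℂ] Fock ι) ∘L C) (ket a)) =
      (((α + if a ∈ s then β else 0) ^ 2 : ℝ) : ℂ) * element ρ a a := by
    intro a
    simp only [ContinuousLinearMap.comp_apply]
    rw [hC, ← diagonalScaling_symmetric, diagonalScaling_ket, map_smul, inner_smul_left,
      inner_smul_right, Complex.conj_ofReal, element]
    push_cast
    ring
  have hmem : C ∘L (ρ : Fock ι →L[ℂ] Fock ι) ∘L C ∈ TraceClass ι := by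
    refine Submodule.subset_span ⟨hpos, ?_⟩
    simp only [he]
    refine Summable.of_norm_bounded
      ((summable_element ρ).norm.mul_left (α ^ 2 + (α + β) ^ 2)) fun a => ?_
    rw [norm_mul, Complex.norm_real, Real.norm_of_nonneg (by positivity)]
    gcongr
    split_ifs
    · nlinarith [sq_nonneg α]
    · nlinarith [sq_nonneg (α + β)]
  exact ⟨⟨_, hmem⟩, hpos, fun _ => rfl, he⟩

/-- The total weight of the diagonal entries in `s`. -/
noncomputable def diagonalWeight {ι : Type} [DecidableEq ι] (s : Finset ι) (ρ : TraceClass ι) : ℝ :=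
  ∑ a ∈ s, (element ρ a a).re

theorem cutoffWeight_eq {n : ℕ} (L : ℕ) (ρ : TraceClass (Fin n → ℕ)) :
    cutoffWeight L ρ = diagonalWeight (cutoffStrings n L) ρ := by
  have h : ∀ a, inner ℂ (ket a) ((cutoffProjector n L ∘L
      (ρ : Fock (Fin n → ℕ) →L[ℂ] Fock (Fin n → ℕ))) (ket a)) =
      if a ∈ cutoffStrings n L then element ρ a a else 0 := by
    intro a
    rw [ContinuousLinearMap.comp_apply, cutoffProjector, ← sum_smul_ket_apply,
      inner_ket_sum_smul_ket, element, inner_ket_left]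
  rw [cutoffWeight, fockTrace]
  simp only [h]
  rw [tsum_eq_sum (s := cutoffStrings n L) (fun a ha => if_neg ha),
    Finset.sum_congr rfl (fun a ha => if_pos ha), Complex.re_sum]
  rfl

theorem diagonalWeight_nonneg {ι : Type} [DecidableEq ι] (s : Finset ι) {ρ : TraceClass ι}
    (hρ : (ρ : Fock ι →L[ℂ] Fock ι).IsPositive) : 0 ≤ diagonalWeight s ρ :=
  Finset.sum_nonneg fun a _ => (Complex.le_def.mp (element_nonneg hρ a)).1

theorem diagonalWeight_add {ι : Type} [DecidableEq ι] (s : Finset ι) (A B : TraceClass ι) :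
    diagonalWeight s (A + B) = diagonalWeight s A + diagonalWeight s B := by
  simp [diagonalWeight, element_add, Finset.sum_add_distrib]

theorem diagonalWeight_ofReal_smul {ι : Type} [DecidableEq ι] (s : Finset ι) (c : ℝ)
    (A : TraceClass ι) : diagonalWeight s ((c : ℂ) • A) = c * diagonalWeight s A := by
  simp [diagonalWeight, element_smul, Finset.mul_sum]

theorem diagonalWeight_le_of_hasSum {ι : Type} [DecidableEq ι] (s : Finset ι) {ρ : TraceClass ι}
    (hρ : (ρ : Fock ι →L[ℂ] Fock ι).IsPositive) {t : ℂ}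
    (ht : HasSum (fun a => element ρ a a) t) : diagonalWeight s ρ ≤ t.re := by
  have h : HasSum (fun a => (element ρ a a).re) t.re := ht.mapL Complex.reCLM
  exact sum_le_hasSum s (fun a _ => (Complex.le_def.mp (element_nonneg hρ a)).1) h

/-- The compression is a finite combination of matrix units, so a channel can be applied term by
term using linearity alone. -/
theorem compression_eq_sum {ι : Type} [DecidableEq ι] {ρ X : TraceClass ι} {s : Finset ι}
    (hX : ∀ v, (X : Fock ι →L[ℂ] Fock ι) v =
      diagonalScaling s 0 1 ((ρ : Fock ι →L[ℂ] Fock ι) (diagonalScaling s 0 1 v))) :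
    X = ∑ a ∈ s, ∑ b ∈ s, element ρ a b • ketBra a b := by
  refine Subtype.ext (ContinuousLinearMap.ext fun v => ?_)
  rw [hX]
  simp only [diagonalScaling_apply, Complex.ofReal_zero, zero_smul, zero_add, Complex.ofReal_one,
    one_smul, map_sum, map_smul, Submodule.coe_sum, Submodule.coe_smul, sum_apply, smul_apply,
    ketBra_apply, inner_ket_left]
  rw [Finset.sum_comm]
  refine Finset.sum_congr rfl fun b _ => ?_
  rw [Finset.smul_sum]
  refine Finset.sum_congr rfl fun a _ => ?_
  rw [smul_smul, smul_smul, element, inner_ket_left, mul_comm]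

/-- `X₁` rescales `ρ` by `r` on `s` and by `r⁻¹` off `s`. The cross blocks get `r r⁻¹ = 1`, so only
the two diagonal blocks need correcting. -/
theorem gentle_decomposition {ι : Type} [DecidableEq ι] {ρ X₁ X₂ X₃ : TraceClass ι} {s : Finset ι}
    {r : ℝ} (hr : 0 < r)
    (h₁ : ∀ v, (X₁ : Fock ι →L[ℂ] Fock ι) v = diagonalScaling s r⁻¹ (r - r⁻¹)
      ((ρ : Fock ι →L[ℂ] Fock ι) (diagonalScaling s r⁻¹ (r - r⁻¹) v)))
    (h₂ : ∀ v, (X₂ : Fock ι →L[ℂ] Fock ι) v = diagonalScaling s 0 1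
      ((ρ : Fock ι →L[ℂ] Fock ι) (diagonalScaling s 0 1 v)))
    (h₃ : ∀ v, (X₃ : Fock ι →L[ℂ] Fock ι) v = diagonalScaling s 1 (-1)
      ((ρ : Fock ι →L[ℂ] Fock ι) (diagonalScaling s 1 (-1) v))) :
    ρ = X₁ + ((1 - r ^ 2 : ℝ) : ℂ) • X₂ + ((1 - r⁻¹ ^ 2 : ℝ) : ℂ) • X₃ := by
  refine Subtype.ext (ContinuousLinearMap.ext fun v => ?_)
  have hrc : (r : ℂ) ≠ 0 := by exact_mod_cast hr.ne'
  simp only [Submodule.coe_add, Submodule.coe_smul, add_apply, smul_apply, h₁, h₂, h₃,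
    diagonalScaling_apply, sum_smul_ket_apply, map_add, map_smul]
  push_cast
  match_scalars <;> field_simp <;> ring

/-- A form of the gentle measurement lemma: if the compression to `s` is mapped with weight at
least `1 - b` on `s'`, then so is `ρ`, up to `2 √q` where `q` is the weight of `ρ` outside `s`. -/
theorem IsChannel.diagonalWeight_ge {ι κ : Type} [DecidableEq ι] [DecidableEq κ]
    {Q : TraceClass ι →ₗ[ℂ] TraceClass κ} (hQ : IsChannel Q) {ρ : TraceClass ι} (hρ : IsDensity ρ)
    (s : Finset ι) (s' : Finset κ) {b : ℝ} (hb : 0 ≤ b)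
    (hdiag : ∀ a ∈ s, 1 - b ≤ diagonalWeight s' (Q (ketBra a a)))
    (hoff : ∀ a c : ι, a ≠ c → ∀ l, element (Q (ketBra a c)) l l = 0) :
    1 - 2 * Real.sqrt (1 - diagonalWeight s ρ) - b ≤ diagonalWeight s' (Q ρ) := by
  set w := diagonalWeight s ρ with hw
  have hw0 : 0 ≤ w := diagonalWeight_nonneg s hρ.1
  have hw1 : w ≤ 1 := by simpa using diagonalWeight_le_of_hasSum s hρ.1 hρ.2
  obtain ⟨X₂, p₂, f₂, -⟩ := exists_compression hρ.1 s 0 1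
  obtain ⟨X₃, p₃, f₃, e₃⟩ := exists_compression hρ.1 s 1 (-1)
  have hW₂ : (1 - b) * w ≤ diagonalWeight s' (Q X₂) := by
    have e : diagonalWeight s' (Q X₂) =
        ∑ a ∈ s, (element ρ a a).re * diagonalWeight s' (Q (ketBra a a)) := by
      have e1 : ∀ l, element (Q X₂) l l =
          ∑ a ∈ s, element ρ a a * element (Q (ketBra a a)) l l := by
        intro l
        rw [compression_eq_sum f₂]
        simp only [map_sum, map_smul, element_sum, element_smul]
        refine Finset.sum_congr rfl fun a ha => ?_
        refine Finset.sum_eq_single_of_mem a ha fun c _ hc => ?_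
        rw [hoff a c hc.symm, mul_zero]
      simp only [diagonalWeight, e1, Complex.re_sum, Finset.mul_sum]
      rw [Finset.sum_comm]
      refine Finset.sum_congr rfl fun a _ => Finset.sum_congr rfl fun l _ => ?_
      have him := (Complex.le_def.mp (element_nonneg hρ.1 a)).2
      rw [Complex.mul_re, ← him]
      simp
    rw [e, hw, diagonalWeight, Finset.mul_sum]
    refine Finset.sum_le_sum fun a ha => ?_
    rw [mul_comm]
    exact mul_le_mul_of_nonneg_left (hdiag a ha) (Complex.le_def.mp (element_nonneg hρ.1 a)).1
  -- The channel preserves positivity and trace, and `X₃` has trace `1 - w`.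
  have hW₃ : diagonalWeight s' (Q X₃) ≤ 1 - w := by
    have h1 : HasSum (fun a => element X₃ a a) (1 - ∑ a ∈ s, element ρ a a) := by
      have h2 := hρ.2.sub (hasSum_sum_of_ne_finset_zero (s := s)
        (f := fun a => if a ∈ s then element ρ a a else 0) (fun a ha => if_neg ha))
      rw [Finset.sum_congr rfl (fun a ha => if_pos ha)] at h2
      refine hasSum_complex_congr h2 (fun a => ?_) rfl
      rw [e₃]
      by_cases ha : a ∈ s <;> simp [ha, element]
    have h3 := diagonalWeight_le_of_hasSum s' (hQ.isPositive p₃) (hQ.hasSum_element X₃)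
    rw [h1.tsum_eq] at h3
    simpa [hw, diagonalWeight] using h3
  -- Here `t = r²`. The image of `X₁` has nonnegative weight and is discarded.
  have key : ∀ t : ℝ, 0 < t → t ≤ 1 →
      (1 - t) * ((1 - b) * w) - (t⁻¹ - 1) * (1 - w) ≤ diagonalWeight s' (Q ρ) := by
    intro t ht0 ht1
    have hr : 0 < Real.sqrt t := Real.sqrt_pos.mpr ht0
    obtain ⟨X₁, p₁, f₁, -⟩ := exists_compression hρ.1 s (Real.sqrt t)⁻¹
      (Real.sqrt t - (Real.sqrt t)⁻¹)
    have hdec := gentle_decomposition hr f₁ f₂ f₃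
    rw [inv_pow, Real.sq_sqrt ht0.le] at hdec
    rw [hdec, map_add, map_add, map_smul, map_smul, diagonalWeight_add, diagonalWeight_add,
      diagonalWeight_ofReal_smul, diagonalWeight_ofReal_smul]
    have h1 := diagonalWeight_nonneg s' (hQ.isPositive p₁)
    have h2 := mul_le_mul_of_nonneg_left hW₂ (by linarith : 0 ≤ 1 - t)
    have h3 := mul_le_mul_of_nonneg_left hW₃
      (by linarith [(one_le_inv₀ ht0).mpr ht1] : 0 ≤ t⁻¹ - 1)
    linarith
  have hbw : ∀ t : ℝ, 0 ≤ t → t ≤ 1 → (1 - t) * w - b ≤ (1 - t) * ((1 - b) * w) := by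
    intro t ht0 ht1
    have h1 : (1 - t) * w ≤ 1 := mul_le_one₀ (by linarith) hw0 hw1
    have h2 := mul_le_mul_of_nonneg_left h1 hb
    linarith
  -- The choice `t = √q` balances the losses `t` and `q / t`. It is not admissible for `q = 0`,
  -- where `t` is made arbitrarily small instead.
  rcases hw1.eq_or_lt with h | h
  · rw [h, sub_self, Real.sqrt_zero, mul_zero, sub_zero]
    refine le_of_forall_pos_le_add fun ε hε => ?_
    have ht0 : 0 < min ε 1 := lt_min hε one_pos
    have k1 := key (min ε 1) ht0 (min_le_right _ _)
    have k2 := hbw (min ε 1) ht0.le (min_le_right _ _)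
    rw [h, sub_self, mul_zero, sub_zero] at k1
    rw [h] at k2
    linarith [min_le_left ε 1]
  · set q := 1 - w with hq
    have hq0 : 0 < q := by linarith
    have ht0 : 0 < Real.sqrt q := Real.sqrt_pos.mpr hq0
    have ht1 : Real.sqrt q ≤ 1 := Real.sqrt_le_one.mpr (by linarith)
    have k1 := key (Real.sqrt q) ht0 ht1
    have k2 := hbw (Real.sqrt q) ht0.le ht1
    have e : (Real.sqrt q)⁻¹ * q = Real.sqrt q := by
      rw [inv_mul_eq_iff_eq_mul₀ ht0.ne', Real.mul_self_sqrt hq0.le]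
    have hwq : w = 1 - q := by linarith
    rw [hwq] at k1 k2
    have : 0 ≤ Real.sqrt q * q := by positivity
    linarith

/-! ### Tensor powers -/

theorem isProductOperator_ketBra {n : ℕ} (a b : Fin n → ℕ) :
    IsProductOperator (fun i => ketBra (a i) (b i)) (ketBra a b) := by
  intro l m
  have h := element_ketBra a b l m
  have h' := fun i => element_ketBra (a i) (b i) (l i) (m i)
  simp only [element] at h h'
  rw [h, Finset.prod_congr rfl fun i _ => h' i, Finset.prod_mul_distrib, Finset.prod_boole,
    Finset.prod_boole]
  simp [funext_iff]

/-- On the diagonal, with `a = b`, this says that the output photon numbers of the modes are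
independent. -/
theorem IsTensorPower.element_ketBra {n : ℕ} {P : TraceClass ℕ →ₗ[ℂ] TraceClass ℕ}
    {Q : TraceClass (Fin n → ℕ) →ₗ[ℂ] TraceClass (Fin n → ℕ)} (hQ : IsTensorPower P Q)
    (a b l m : Fin n → ℕ) :
    element (Q (ketBra a b)) l m = ∏ i, element (P (ketBra (a i) (b i))) (l i) (m i) :=
  hQ.map_tensor _ _ (isProductOperator_ketBra a b) l m

theorem IsTensorPower.diagonalWeight_ge {τ ν : ℝ} (hτ : 0 ≤ τ) (hκ : 0 ≤ (τ + ν - 1) / 2)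
    {P : TraceClass ℕ →ₗ[ℂ] TraceClass ℕ} (hP : IsPhaseInsensitiveGaussian τ ν P)
    {N δ : ℝ} (hN : 0 ≤ N) (hδ : 0 < δ) {n : ℕ} (hn : 2 ≤ n) (hn1 : 2 * τ ≤ n)
    (hn2 : 2 * (τ + 2 * τ ^ 2 * (N + 1)) / δ ≤ n)
    {Q : TraceClass (Fin n → ℕ) →ₗ[ℂ] TraceClass (Fin n → ℕ)} (hQ : IsTensorPower P Q)
    {a : Fin n → ℕ} (ha : ∑ i, a i ≤ ⌈n * N⌉₊) :
    1 - (Real.exp (((τ + ν - 1) / 2 + ((τ + ν - 1) / 2) ^ 2 +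
          4 * τ * (1 + 2 * ((τ + ν - 1) / 2)) * (N + 1)) / n) - 1) /
        (1 - Real.exp (-(δ / 2))) ^ 2 ≤
      diagonalWeight (cutoffStrings n ⌈n * ((τ * N + (τ + ν - 1) / 2) + δ)⌉₊)
        (Q (ketBra a a)) := by
  have hpos : ∀ i l, 0 ≤ element (P (ketBra (a i) (a i))) l l := fun i l =>
    element_nonneg (hP.channel.isPositive (ketBra_self_isPositive _)) l
  have hreal : ∀ i l, ((element (P (ketBra (a i) (a i))) l l).re : ℂ) =
      element (P (ketBra (a i) (a i))) l l := fun i l =>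
    Complex.ext rfl (by simpa using (Complex.le_def.mp (hpos i l)).2)
  refine (cutoff_sum_ge_of_outputGenerating hτ hκ hN hδ hn hn1 hn2 ha
    (p := fun i l => (element (P (ketBra (a i) (a i))) l l).re)
    (fun i l => (Complex.le_def.mp (hpos i l)).1) (fun i => ?_) (fun y hy0 hy1 i => ?_)).trans
    (le_of_eq ?_)
  · have h := hP.channel.hasSum_element (ketBra (a i) (a i))
    have e : ∑' l, element (ketBra (a i) (a i)) l l = 1 := by
      rw [tsum_eq_single (a i)]
      · simp [_root_.element_ketBra]
      · intro l hl
        simp [_root_.element_ketBra, hl]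
    rw [e] at h
    exact h.mapL Complex.reCLM
  · have h := hP.hasSum_generating hτ hκ (a i) (a i) hy0 hy1
    rw [if_pos rfl] at h
    refine Complex.hasSum_ofReal.mp (hasSum_complex_congr h (fun l => ?_) rfl)
    rw [Complex.ofReal_mul, hreal i l]
  · refine Finset.sum_congr rfl fun l _ => ?_
    rw [hQ.element_ketBra, Finset.prod_congr rfl fun i _ => (hreal i (l i)).symm,
      ← Complex.ofReal_prod, Complex.ofReal_re]

theorem IsTensorPower.element_offDiagonal {τ ν : ℝ} (hτ : 0 ≤ τ) (hκ : 0 ≤ (τ + ν - 1) / 2)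
    {P : TraceClass ℕ →ₗ[ℂ] TraceClass ℕ} (hP : IsPhaseInsensitiveGaussian τ ν P) {n : ℕ}
    {Q : TraceClass (Fin n → ℕ) →ₗ[ℂ] TraceClass (Fin n → ℕ)} (hQ : IsTensorPower P Q)
    {a b : Fin n → ℕ} (hab : a ≠ b) (l : Fin n → ℕ) : element (Q (ketBra a b)) l l = 0 := by
  obtain ⟨i, hi⟩ := Function.ne_iff.mp hab
  rw [hQ.element_ketBra]
  exact Finset.prod_eq_zero (Finset.mem_univ i) (hP.element_offDiagonal hτ hκ hi (l i))

/-- For small `n` any error at least `1` makes the claim trivial, as weights are nonnegative. The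
constant `f n₀ + 1` serves there and keeps the function non-increasing. -/
theorem exists_antitone_extension {f : ℕ → ℝ} (n₀ : ℕ) (hf0 : ∀ n, n₀ ≤ n → 0 ≤ f n)
    (hf : ∀ m n, n₀ ≤ m → m ≤ n → f n ≤ f m)
    (hlim : Filter.Tendsto f Filter.atTop (nhds 0)) :
    ∃ g : ℕ → ℝ, Antitone g ∧ Filter.Tendsto g Filter.atTop (nhds 0) ∧
      (∀ n, n₀ ≤ n → g n = f n) ∧ ∀ n, n < n₀ → 1 ≤ g n := by
  refine ⟨fun n => if n < n₀ then f n₀ + 1 else f n, fun m n hmn => ?_, ?_, fun n hn => ?_,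
    fun n hn => ?_⟩
  · by_cases hn : n < n₀
    · simp [hn, lt_of_le_of_lt hmn hn]
    · by_cases hm : m < n₀
      · simp only [hn, hm, if_true, if_false]
        linarith [hf n₀ n le_rfl (not_lt.mp hn)]
      · simpa [hn, hm] using hf m n (not_lt.mp hm) hmn
  · refine hlim.congr' ?_
    filter_upwards [Filter.eventually_ge_atTop n₀] with n hn
    rw [if_neg (not_lt.mpr hn)]
  · simp [not_lt.mpr hn]
  · simp only [hn, if_true]
    linarith [hf0 n₀ le_rfl]

theorem tendsto_exp_div_sub_one (C D : ℝ) :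
    Filter.Tendsto (fun n : ℕ => (Real.exp (C / n) - 1) / D) Filter.atTop (nhds 0) := by
  have h := (((Real.continuous_exp.tendsto 0).comp
    (tendsto_const_div_atTop_nhds_zero_nat C)).sub_const 1).div_const D
  rw [Real.exp_zero, sub_self, zero_div] at h
  exact h

end

/-! ### Number-state concentration combined with gentle compression -/

theorem lemma1 (τ ν : ℝ) (hτ : 0 ≤ τ) (hν : 0 ≤ ν) (hτν : (τ - 1) ^ 2 ≤ ν ^ 2)
    (P : TraceClass ℕ →ₗ[ℂ] TraceClass ℕ) (hP : IsPhaseInsensitiveGaussian τ ν P)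
    (N_S : ℝ) (hN_S : 0 ≤ N_S) (δ₂ : ℝ) (hδ₂ : 0 < δ₂) :
    ∃ δ₃ : ℕ → ℝ, Antitone δ₃ ∧ Filter.Tendsto δ₃ Filter.atTop (nhds 0) ∧
      ∀ δ₁ : ℕ → ℝ, (∀ n, 0 ≤ δ₁ n) →
        ∀ (n : ℕ) (Pn : TraceClass (Fin n → ℕ) →ₗ[ℂ] TraceClass (Fin n → ℕ)),
          IsTensorPower P Pn →
          ∀ ρ : TraceClass (Fin n → ℕ), IsDensity ρ →
            1 - δ₁ n ≤ cutoffWeight ⌈n * N_S⌉₊ ρ →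
            1 - δ₁ n - 2 * Real.sqrt (δ₁ n) - δ₃ n ≤
              cutoffWeight ⌈n * ((τ * N_S + (τ + ν - 1) / 2) + δ₂)⌉₊ (Pn ρ) := by
  -- The hypothesis gives `1 - τ ≤ ν`: the added photon number is nonnegative.
  have hκ : 0 ≤ (τ + ν - 1) / 2 := by
    have := abs_le_of_sq_le_sq hτν hν
    linarith [(abs_le.mp this).1]
  set κ := (τ + ν - 1) / 2 with hκdef
  set C := κ + κ ^ 2 + 4 * τ * (1 + 2 * κ) * (N_S + 1) with hC
  have hC0 : 0 ≤ C := by positivity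
  set D := (1 - Real.exp (-(δ₂ / 2))) ^ 2 with hD
  have hD0 : 0 ≤ D := sq_nonneg _
  -- Beyond `m + 2` all size conditions of the concentration estimate hold; the threshold depends
  -- only on `τ`, `N_S` and `δ₂`.
  obtain ⟨m, hm⟩ := exists_nat_ge (max (2 * τ) (2 * (τ + 2 * τ ^ 2 * (N_S + 1)) / δ₂))
  have hb0 : ∀ n : ℕ, m + 2 ≤ n → 0 ≤ (Real.exp (C / n) - 1) / D := fun n _ =>
    div_nonneg (sub_nonneg.mpr (Real.one_le_exp (by positivity))) hD0
  obtain ⟨δ₃, hanti, hlim, hge, hlt⟩ := exists_antitone_extension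
    (f := fun n : ℕ => (Real.exp (C / n) - 1) / D) (m + 2) hb0
    (fun k n hk hkn => by
      have : (0 : ℝ) < k := by exact_mod_cast (by omega : 0 < k)
      gcongr) (tendsto_exp_div_sub_one C D)
  refine ⟨δ₃, hanti, hlim, fun δ₁ hδ₁ n Pn hPn ρ hρ hw => ?_⟩
  rw [cutoffWeight_eq] at hw ⊢
  have hs := Real.sqrt_nonneg (δ₁ n)
  rcases lt_or_ge n (m + 2) with hn | hn
  · have h0 := diagonalWeight_nonneg
      (cutoffStrings n ⌈n * ((τ * N_S + κ) + δ₂)⌉₊) (hPn.channel.isPositive hρ.1)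
    linarith [hlt n hn, hδ₁ n]
  · have hmn : (m : ℝ) ≤ n := by exact_mod_cast (by omega : m ≤ n)
    have hn1 := (le_max_left _ _).trans (hm.trans hmn)
    have hn2 := (le_max_right _ _).trans (hm.trans hmn)
    have h := hPn.channel.diagonalWeight_ge hρ (cutoffStrings n ⌈n * N_S⌉₊)
      (cutoffStrings n ⌈n * ((τ * N_S + κ) + δ₂)⌉₊) (hb0 n hn)
      (fun a ha => IsTensorPower.diagonalWeight_ge hτ hκ hP hN_S hδ₂ (by omega) hn1 hn2 hPn
        (mem_cutoffStrings.mp ha))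
      (fun a b hab l => hPn.element_offDiagonal hτ hκ hP hab l)
    -- The weight outside the input cutoff is at most `δ₁ n`. The resulting bound `1 - 2√δ₁ - δ₃` is
    -- already stronger than the claim.
    have hsqrt : Real.sqrt (1 - diagonalWeight (cutoffStrings n ⌈n * N_S⌉₊) ρ) ≤
        Real.sqrt (δ₁ n) := Real.sqrt_le_sqrt (by linarith)
    have hg := hge n hn
    rw [hg]
    linarith [hδ₁ n]
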